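/- \textbf{Lax operators.} In the ring of differential operators $\sum_i p_i\partial^i$ whose coefficients are differential polynomials in one function $u$, with the grading $\deg u^{(j)}=j+2$, $\deg\partial=1$, and with the formal conjugation $^*$ (the anti-automorphism with $\partial^*=-\partial$, $f^*=f$ for multiplication operators), let $A_k=\partial^{2k+1}+\sum_{i<2k+1}P_{k,i}\partial^i$ ($k\ge 0$) be the anti-symmetric homogeneous operator of degree $2k+1$ for which $r_k[u]:=[A_k,\partial^2-u]$ is a multiplication operator. For example $A_0=\partial$, $A_1=\partial^3-\tfrac32u\,\partial-\tfrac34u'$. \textbf{Setting.} Let $g\ge 1$ and let $u_1,\dots,u_g$ be smooth (real or complex valued) functions of real variables $t_1=x,t_2,\dots,t_g$, or holomorphic functions of complex variables, on a non-empty connected open set. Put $\partial_i=\partial/\partial t_i$ for $1\le i\le g$, $\partial_{g+1}=0$, denote by a prime the derivative with respect to $x$, and put $$\mathcal L=\partial_x^2-u_1,\qquad \mathcal U_i=\partial_x^2\partial_i-\tfrac12(u_1\partial_i+\partial_iu_1)-\tfrac14(u_i\partial_x+\partial_xu_i)-\partial_{i+1}\quad(1\le i\le g),$$ where $u_i$ stands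 for multiplication by $u_i$. \textbf{Theorem.} Suppose that the operators $\mathcal L,\mathcal U_1,\dots,\mathcal U_g$ commute pairwise. Then there are constants $\mu_1,\dots,\mu_{2g}$ such that, with $\mathbf u(\xi)=\sum_{i=1}^g u_i\xi^i$ and $\mu(\xi)=4\xi^{-1}+\sum_{i=1}^{2g}\mu_i\xi^i$, $$4\mu(\xi)=\mathbf u'(\xi)^2+2\,\mathbf u''(\xi)\,(2-\mathbf u(\xi))+4(\xi^{-1}+u_1)(2-\mathbf u(\xi))^2 ,$$ and there are constants $a_0,\dots,a_{g-2}$ such that, with $A_k$ formed for the function $u=u_1$ and $\partial=\partial_x$, $$A_g+\sum_{i=0}^{g-2}a_iA_i=\mathcal U_1\mathcal L^{g-1}+\mathcal U_2\mathcal L^{g-2}+\dots+\mathcal U_g .$$ The function $u_1$ satisfies the stationary $g$-KdV equation $r_g[u_1]+\sum_{k=0}^{g-2}a_kr_k[u_1]=0$ with these $a_k$, and $$\mu_k=8a_{g-k-1}+4\sum_{i=1}^{k-2}a_{g-i-1}a_{g-k+i}\qquad\text{for }k=1,\dots,g-1 .$$ If moreover $\partial_1u_1,\dots,\partial_gu_1$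 are linearly independent over the constants, then $(a_0,\dots,a_{g-2})$ is the only tuple of constants for which $u_1$ satisfies this stationary $g$-KdV equation. -/

import Mathlib

open scoped ContDiff

namespace KdV

noncomputable section

/-! ## Formal differential operators in one variable

`DiffPoly F` is the ring of differential polynomials `F[u, u', u'', …]`; the variable `X j` is the
`j`-th derivative of `u`. -/

/-- Differential polynomials in one unknown function `u`; `X j` stands for `u^(j)`. -/
abbrev DiffPoly (F : Type*) [Field F] : Type _ := MvPolynomial ℕ F

/-- The derivation `∂` of differential polynomials, `∂ u^(j) = u^(j+1)`. -/
def D (F : Type*) [Field F] : Module.End F (DiffPoly F) :=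
  (MvPolynomial.mkDerivation F
    (fun j : ℕ => (MvPolynomial.X (j + 1) : DiffPoly F))).toLinearMap

/-- A formal differential operator `∑ i, c i ∂^i`, given by its coefficients. -/
abbrev FormalOp (F : Type*) [Field F] : Type _ := ℕ →₀ DiffPoly F

/-- The operator `∑ i, c i ∂^i` acting on differential polynomials. This action is faithful, so
products and commutators of operators are taken in `Module.End F (DiffPoly F)`. -/
def FormalOp.toEnd {F : Type*} [Field F] (c : FormalOp F) : Module.End F (DiffPoly F) :=
  c.sum fun i p => LinearMap.mulLeft F p * D F ^ i

/-- The formal conjugate `∑ i, (-∂)^i ∘ c i` of `∑ i, c i ∂^i`. -/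
def FormalOp.conj {F : Type*} [Field F] (c : FormalOp F) : Module.End F (DiffPoly F) :=
  c.sum fun i p => (-D F) ^ i * LinearMap.mulLeft F p

/-- The formal Schrödinger operator `∂² - u`. -/
def formalL (F : Type*) [Field F] : Module.End F (DiffPoly F) :=
  D F ^ 2 - LinearMap.mulLeft F (MvPolynomial.X 0)

/-- `A` is the `k`-th Lax operator: `A = ∂^(2k+1) + ∑_{i < 2k+1} P_i ∂^i`, where `P_i` is a
differential polynomial, homogeneous of degree `2k+1-i` for the grading `deg u^(j) = j + 2`;
`A` is anti-symmetric; and `[A, ∂² - u]` is the multiplication by a function. -/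
structure IsLaxOperator {F : Type*} [Field F] (k : ℕ) (A : FormalOp F) : Prop where
  leading : A (2 * k + 1) = 1
  order_le : ∀ i, 2 * k + 1 < i → A i = 0
  homogeneous : ∀ i, i ≤ 2 * k + 1 →
    MvPolynomial.IsWeightedHomogeneous (fun j : ℕ => j + 2) (A i) (2 * k + 1 - i)
  antisymmetric : A.conj = -A.toEnd
  commutator : ∃ r : DiffPoly F, A.toEnd * formalL F - formalL F * A.toEnd = LinearMap.mulLeft F r

/-- The Lax operator `A_k`: the operator singled out by `IsLaxOperator k`. -/
def laxOperator (F : Type*) [Field F] (k : ℕ) : FormalOp F :=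
  Classical.epsilon (IsLaxOperator k)

/-- The differential polynomial `r_k[u] = [A_k, ∂² - u]`: the commutator is a multiplication
operator, and the function it multiplies by is its value at `1`. -/
def kdvPoly (F : Type*) [Field F] (k : ℕ) : DiffPoly F :=
  ((laxOperator F k).toEnd * formalL F - formalL F * (laxOperator F k).toEnd) 1

/-! ## Operators on functions of `t_1 = x, t_2, …, t_g`

The variables range over `𝕜^g`, functions have values in `F`. Indices start at `1`: the coordinate
`t_i` is the one with index `i - 1` in `Fin g`. -/

section Functions

variable {𝕜 F : Type*} [RCLike 𝕜] [RCLike F] [NormedAlgebra 𝕜 F] {g : ℕ}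

/-- The partial derivative `∂_i = ∂/∂t_i` for `1 ≤ i ≤ g`. For other `i` (in particular for
`i = g + 1`) the direction is the zero vector and `∂_i = 0`. -/
def pd (i : ℕ) (f : (Fin g → 𝕜) → F) : (Fin g → 𝕜) → F :=
  fun t => fderiv 𝕜 f t (fun j : Fin g => if (j : ℕ) + 1 = i then (1 : 𝕜) else 0)

/-- Two operators agree on `U`: they agree on all smooth functions on `U` (holomorphic functions if
`𝕜 = ℂ`). -/
def OpEqOn (U : Set (Fin g → 𝕜)) (P Q : ((Fin g → 𝕜) → F) → ((Fin g → 𝕜) → F)) : Prop :=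
  ∀ f : (Fin g → 𝕜) → F, ContDiffOn 𝕜 ∞ f U → Set.EqOn (P f) (Q f) U

/-- Two operators commute on `U`. -/
def OpCommuteOn (U : Set (Fin g → 𝕜)) (P Q : ((Fin g → 𝕜) → F) → ((Fin g → 𝕜) → F)) : Prop :=
  OpEqOn U (P ∘ Q) (Q ∘ P)

/-- The Schrödinger operator `L = ∂_x² - u_1`. -/
def opL (u : ℕ → (Fin g → 𝕜) → F) (f : (Fin g → 𝕜) → F) : (Fin g → 𝕜) → F :=
  pd 1 (pd 1 f) - u 1 * f

/-- `∂_x² ∂_k - (1/2) (u_1 ∂_k + ∂_k u_1) - (1/4) (u_k ∂_x + ∂_x u_k)`, where `u_1`, `u_k` are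
multiplication operators. -/
def opA (u : ℕ → (Fin g → 𝕜) → F) (k : ℕ) (f : (Fin g → 𝕜) → F) : (Fin g → 𝕜) → F :=
  pd 1 (pd 1 (pd k f)) - (1 / 2 : F) • (u 1 * pd k f + pd k (u 1 * f))
    - (1 / 4 : F) • (u k * pd 1 f + pd 1 (u k * f))

/-- `U_k = opA u k - ∂_{k+1}`, with `∂_{g+1} = 0`. -/
def opU (u : ℕ → (Fin g → 𝕜) → F) (k : ℕ) (f : (Fin g → 𝕜) → F) : (Fin g → 𝕜) → F :=
  opA u k f - pd (k + 1) f

/-- The operators `L, U_1, …, U_g` pairwise commute on `U`. -/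
def CommutingFamily (U : Set (Fin g → 𝕜)) (u : ℕ → (Fin g → 𝕜) → F) : Prop :=
  (∀ k ∈ Finset.Icc 1 g, OpCommuteOn U (opL u) (opU u k)) ∧
  (∀ i ∈ Finset.Icc 1 g, ∀ k ∈ Finset.Icc 1 g, OpCommuteOn U (opU u i) (opU u k))

/-- The value at `v` of a differential polynomial, `u^(j)` being the `j`-th derivative of `v` with
respect to `x = t_1`. -/
def evalDiffPoly (v : (Fin g → 𝕜) → F) (p : DiffPoly F) : (Fin g → 𝕜) → F :=
  fun t => MvPolynomial.eval (fun j : ℕ => (pd 1)^[j] v t) p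

/-- The Lax operator `A_k` with `u` replaced by the function `v`. -/
def opLax (v : (Fin g → 𝕜) → F) (k : ℕ) (f : (Fin g → 𝕜) → F) : (Fin g → 𝕜) → F :=
  (laxOperator F k).sum fun i p => evalDiffPoly v p * (pd 1)^[i] f

/-- The stationary `g`-KdV (Novikov) equation `r_g[v] + ∑_{k=0}^{g-2} a_k r_k[v] = 0` on `U`. -/
def NovikovEq (U : Set (Fin g → 𝕜)) (a : ℕ → F) (v : (Fin g → 𝕜) → F) : Prop :=
  ∀ t ∈ U, evalDiffPoly v (kdvPoly F g) t
    + ∑ k ∈ Finset.range (g - 1), a k * evalDiffPoly v (kdvPoly F k) t = 0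

/-- The generating function `∑_{i=1}^g v_i ξ^i` at the point `t`. -/
def gen (v : ℕ → (Fin g → 𝕜) → F) (t : Fin g → 𝕜) (ξ : F) : F :=
  ∑ i ∈ Finset.Icc 1 g, v i t * ξ ^ i

/-- With `𝐮(ξ) = ∑ u_i ξ^i` and `μ(ξ) = 4 ξ⁻¹ + ∑_{i=1}^{2g} μ_i ξ^i`, the equation
`4 μ(ξ) = 𝐮'(ξ)² + 2 𝐮''(ξ) (2 - 𝐮(ξ)) + 4 (ξ⁻¹ + u_1) (2 - 𝐮(ξ))²` on `U`. -/
def CurveEq (U : Set (Fin g → 𝕜)) (u : ℕ → (Fin g → 𝕜) → F) (μ : ℕ → F) : Prop :=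
  ∀ t ∈ U, ∀ ξ : F, ξ ≠ 0 →
    4 * (4 * ξ⁻¹ + ∑ i ∈ Finset.Icc 1 (2 * g), μ i * ξ ^ i) =
      gen (fun i => pd 1 (u i)) t ξ ^ 2
        + 2 * gen (fun i => pd 1 (pd 1 (u i))) t ξ * (2 - gen u t ξ)
        + 4 * (ξ⁻¹ + u 1 t) * (2 - gen u t ξ) ^ 2

/-- The first partial derivatives `∂_1 v, …, ∂_g v` are linearly independent over the constants. -/
def IndependentDerivatives (U : Set (Fin g → 𝕜)) (v : (Fin g → 𝕜) → F) : Prop :=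
  ∀ c : ℕ → F, (∀ t ∈ U, ∑ i ∈ Finset.Icc 1 g, c i * pd i v t = 0) →
    ∀ i ∈ Finset.Icc 1 g, c i = 0

end Functions

end

end KdV

/-! Put `v 0 = -2`, `v j = u_j` for `1 ≤ j ≤ g`, `v j = 0` beyond, and `w = ∑ v_j ξ^j = 𝐮(ξ) - 2`.
Everything is a statement about this one series.

Commutation of `U_k` with `L` gives `∂_k u_1 = u_k'` and the Lenard recursion, that is, `w''' = 4
(ξ⁻¹ + u_1) w' + 2 u_1' w`. Commutation of the `U_i` among themselves gives `∂_i u_j = ∂_j u_i` and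
the relation `2 (ξ ∂_{i+1} w - ∂_i w) = ξ (v_i' w - v_i w')`. These make the quadratic first
integral `E(w) = ξ (w'² - 2 w'' w) + 4 (1 + ξ u_1) w²` constant along all flows
(`deriv_energy_eq_zero`), so `E(w) = m` has constant coefficients. This is the curve equation, with
`m = 4 ξ μ(ξ)`.

Over differential polynomials, `E(W) = 16` has exactly one solution `W = ∑ w_j ξ^j` with `w_0 = -2`.
Differentiating it yields the Lenard recursion for the `w_j`. With `B(p) = -p ∂ / 2 + p' / 4` it
follows that `A_k = ∑_{j ≤ k} B(w_j) L^(k-j)` and `r_k = -w_{k+1}'`; the Lax operator is unique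
because a homogeneous operator of lower order commuting with `L` up to a function must vanish
(`laxOperator_eq_lenardOp`).

The bridge is `exists_coefficients`. Since `m = 16 + O(ξ²)`, there is a constant series `c = 1 +
O(ξ²)` with `m = 16 c²`. As `E(c W) = c² E(W)`, the series `w` and `c W[u_1]` have equal energy and
equal constant term, hence `w = c W[u_1]`. Set `a_k = c_{g-k}`.

The sum `∑ U_k L^(g-k)` telescopes to `∑ B(v_j) L^(g-j)`, because `U_k = ∂_k L - ∂_{k+1} + B(v_k)`;
expanding `v_j` through `c` turns this into `A_g + ∑ a_k A_k`. The stationary equation is the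
derivative of the coefficient of `ξ^(g+1)` in `w = c W[u_1]`, and the formula for `μ_k` is a
coefficient of `4 c²`. For uniqueness, two solutions give a linear relation among `w_1', …,
w_{g-1}'`; inverting `c` makes it a triangular relation among the `u_j' = ∂_j u_1`. -/

namespace KdV
noncomputable section

open PowerSeries Finset

/-! ### The energy of a power series, and the universal solution of `energy = 16`. -/

section PowerSeriesOverDifferentialRing

variable {F R : Type*} [Field F] [CommRing R] [Algebra F R]

/-- The coefficientwise extension of a derivation to power series. -/
def coeffDeriv (δ : Derivation F R R) : Derivation F R⟦X⟧ R⟦X⟧ :=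
  Derivation.mk'
    { toFun := fun f => PowerSeries.mk fun n => δ (coeff n f)
      map_add' := fun f h => by ext n; simp
      map_smul' := fun c f => by ext n; simp }
    (fun f h => by
      ext n
      simp [coeff_mul, map_sum, sum_add_distrib]
      nth_rewrite 2 [← Finset.Nat.sum_antidiagonal_swap]
      simp)

@[simp]
theorem coeff_coeffDeriv (δ : Derivation F R R) (f : R⟦X⟧) (n : ℕ) :
    coeff n (coeffDeriv δ f) = δ (coeff n f) := by
  simp [coeffDeriv]

@[simp]
theorem coeffDeriv_X (δ : Derivation F R R) : coeffDeriv δ (X : R⟦X⟧) = 0 := by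
  ext n
  rw [coeff_coeffDeriv, coeff_X]
  split_ifs <;> simp

@[simp]
theorem coeffDeriv_C (δ : Derivation F R R) (r : R) :
    coeffDeriv δ (C r : R⟦X⟧) = C (δ r) := by
  ext n
  rw [coeff_coeffDeriv, coeff_C, coeff_C]
  split_ifs <;> simp

@[simp]
theorem coeffDeriv_map (δ : Derivation F R R) (c : F⟦X⟧) :
    coeffDeriv δ (PowerSeries.map (algebraMap F R) c) = 0 := by
  ext n
  simp

theorem coeffDeriv_comm {δ ε : Derivation F R R} (h : ∀ r, δ (ε r) = ε (δ r)) (f : R⟦X⟧) :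
    coeffDeriv δ (coeffDeriv ε f) = coeffDeriv ε (coeffDeriv δ f) := by
  ext n
  simp [h]

/-- The quadratic first integral `ξ (w'² - 2 w'' w) + 4 (1 + ξ u) w²` of the linear equation
`w''' = 4 (ξ⁻¹ + u) w' + 2 u' w`. -/
def energy (δ : Derivation F R R) (u : R) (w : R⟦X⟧) : R⟦X⟧ :=
  X * (coeffDeriv δ w ^ 2 - 2 * coeffDeriv δ (coeffDeriv δ w) * w) + 4 * (1 + X * C u) * w ^ 2

/-- The second factor is the defect of the third-order linear equation. Over a domain the identity
can be read backwards: constant energy of a nonzero series forces the linear equation, which is how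
the Lenard recursion is obtained. -/
theorem deriv_energy (δ : Derivation F R R) (u : R) (w : R⟦X⟧) :
    coeffDeriv δ (energy δ u w) = -2 * w * (X * coeffDeriv δ (coeffDeriv δ (coeffDeriv δ w))
      - 4 * (1 + X * C u) * coeffDeriv δ w - 2 * X * C (δ u) * w) := by
  have h2 : coeffDeriv δ (2 : R⟦X⟧) = 0 := by simpa using (coeffDeriv δ).map_natCast 2
  have h4 : coeffDeriv δ (4 : R⟦X⟧) = 0 := by simpa using (coeffDeriv δ).map_natCast 4
  simp only [energy, pow_two, map_add, map_sub, Derivation.leibniz, smul_eq_mul, coeffDeriv_X,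
    coeffDeriv_C, h2, h4, Derivation.map_one_eq_zero]
  ring

/-- The energy is quadratic and constant series pass through the derivation. Hence solutions of
different constant energies differ by the square root of the ratio. -/
theorem energy_mul_map (δ : Derivation F R R) (u : R) (c : F⟦X⟧) (w : R⟦X⟧) :
    energy δ u (PowerSeries.map (algebraMap F R) c * w) =
      PowerSeries.map (algebraMap F R) (c ^ 2) * energy δ u w := by
  simp only [energy, Derivation.leibniz, smul_eq_mul, coeffDeriv_map, map_pow, mul_zero, add_zero]
  ring

/-- A solution of `energy w = m` is determined by its constant term. -/
theorem energy_injective [CharZero F] {δ : Derivation F R R} {u : R} {w v : R⟦X⟧}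
    (hw : constantCoeff w = -2) (hv : constantCoeff v = -2)
    (h : energy δ u w = energy δ u v) : w = v := by
  -- `ξ`-adic approximation: in the difference of the two energies the derivatives carry an extra
  -- factor `ξ`, so the lowest coefficient of `w - v` is fixed by algebra alone.
  have key : ∀ n, (X : R⟦X⟧) ^ n ∣ w - v := by
    intro n
    induction n with
    | zero => simp
    | succ n ih =>
      obtain ⟨q, hq⟩ := ih
      have e : ∀ f : R⟦X⟧, coeffDeriv δ (X ^ n * f) = X ^ n * coeffDeriv δ f := fun f => by
        simp [Derivation.leibniz, Derivation.leibniz_pow]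
      have hw' : w = v + X ^ n * q := by rw [← hq]; ring
      have h0 : X ^ n * (X * (coeffDeriv δ q * (coeffDeriv δ w + coeffDeriv δ v)
          - 2 * coeffDeriv δ (coeffDeriv δ q) * w - 2 * coeffDeriv δ (coeffDeriv δ v) * q)
          + 4 * (1 + X * C u) * (w + v) * q) = 0 := by
        have e1 : coeffDeriv δ w = coeffDeriv δ v + X ^ n * coeffDeriv δ q := by
          conv_lhs => rw [hw', map_add, e]
        have e2 : coeffDeriv δ (coeffDeriv δ w) =
            coeffDeriv δ (coeffDeriv δ v) + X ^ n * coeffDeriv δ (coeffDeriv δ q) := by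
          rw [e1, map_add, e]
        have h1 := sub_eq_zero.2 h
        simp only [energy] at h1
        rw [← h1, e2, e1, hw']
        ring
      -- The constant term of the bracket is `4 (w_0 + v_0) q_0 = -16 q_0`.
      have h1 := congrArg (coeff n) h0
      rw [coeff_X_pow_mul', if_pos le_rfl, Nat.sub_self, coeff_zero_eq_constantCoeff_apply] at h1
      simp only [map_add, map_mul, map_sub, hw, hv, constantCoeff_X, map_zero, zero_mul,
        zero_add, map_one, add_zero, mul_one] at h1
      have h4 : constantCoeff (4 : R⟦X⟧) = 4 := map_ofNat _ 4
      have hq0 : constantCoeff q = 0 := by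
        have : (16 : F) • constantCoeff q = 0 := by
          rw [h4] at h1
          rw [Algebra.smul_def, ← neg_eq_zero, ← h1, map_ofNat]
          ring
        exact (smul_eq_zero_iff_right (by norm_num : (16 : F) ≠ 0)).1 this
      obtain ⟨q', rfl⟩ := X_dvd_iff.2 hq0
      exact ⟨q', by rw [hq, pow_succ, mul_assoc]⟩
  rw [← sub_eq_zero]
  ext n
  exact X_pow_dvd_iff.1 (key (n + 1)) n (Nat.lt_succ_self n)

theorem sum_range_mul_self {S : Type*} [CommSemiring S] (f : ℕ → S) (n : ℕ) :
    ∑ k ∈ range (n + 1 + 1), f k * f (n + 1 - k) =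
      2 * (f 0 * f (n + 1)) + ∑ k ∈ range n, f (k + 1) * f (n - k) := by
  rw [sum_range_succ, sum_range_succ']
  simp only [Nat.sub_zero, Nat.sub_self, Nat.add_sub_add_right]
  ring

/-- The coefficients of the solution of `energy w = 16` with constant term `-2`. -/
def energySeq (δ : Derivation F R R) (u : R) : ℕ → R
  | 0 => -2
  -- The coefficient of `ξ^(n+1)` in the energy contains `w_{n+1}` only through `8 w_0 w_{n+1} = -16
  -- w_{n+1}`; the equation is solved for it.
  | n + 1 => (1 / 16 : F) •
      (∑ i : Fin (n + 1), (δ (energySeq δ u i) * δ (energySeq δ u (n - i))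
          - 2 * δ (δ (energySeq δ u i)) * energySeq δ u (n - i)
          + 4 * u * (energySeq δ u i * energySeq δ u (n - i)))
        + 4 * ∑ i : Fin n, energySeq δ u (i + 1) * energySeq δ u (n - i))

theorem energy_energySeq [CharZero F] (δ : Derivation F R R) (u : R) :
    energy δ u (PowerSeries.mk (energySeq δ u)) = 16 := by
  have hE : energy δ u (PowerSeries.mk (energySeq δ u)) =
      X * (coeffDeriv δ (PowerSeries.mk (energySeq δ u)) *
        coeffDeriv δ (PowerSeries.mk (energySeq δ u))
        - C 2 * (coeffDeriv δ (coeffDeriv δ (PowerSeries.mk (energySeq δ u)))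
          * PowerSeries.mk (energySeq δ u))
        + C (4 * u) * (PowerSeries.mk (energySeq δ u) * PowerSeries.mk (energySeq δ u)))
      + C 4 * (PowerSeries.mk (energySeq δ u) * PowerSeries.mk (energySeq δ u)) := by
    rw [map_mul C, map_ofNat C 2, map_ofNat C 4, energy]
    ring
  have h16 : (16 : R⟦X⟧) = C 16 := (map_ofNat C 16).symm
  rw [hE, h16]
  ext n
  rw [coeff_C]
  rcases n with _ | n
  · simp [energySeq]; norm_num
  rw [if_neg (Nat.succ_ne_zero n), map_add, coeff_succ_X_mul, map_add, map_sub, coeff_C_mul,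
    coeff_C_mul, coeff_C_mul]
  simp only [coeff_mul, coeff_coeffDeriv, coeff_mk]
  simp only [Nat.sum_antidiagonal_eq_sum_range_succ_mk]
  rw [sum_range_mul_self]
  have hs : (16 : R) * energySeq δ u (n + 1) =
      ∑ i ∈ range (n + 1), (δ (energySeq δ u i) * δ (energySeq δ u (n - i))
          - 2 * δ (δ (energySeq δ u i)) * energySeq δ u (n - i)
          + 4 * u * (energySeq δ u i * energySeq δ u (n - i)))
        + 4 * ∑ i ∈ range n, energySeq δ u (i + 1) * energySeq δ u (n - i) := by
    rw [energySeq, sum_range, sum_range]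
    have : (16 : R) = algebraMap F R 16 := (map_ofNat _ 16).symm
    rw [this, ← Algebra.smul_def, smul_smul]
    norm_num
  have h0 : energySeq δ u 0 = -2 := by rw [energySeq]
  rw [h0]
  simp only [sum_add_distrib, sum_sub_distrib, mul_assoc, ← Finset.mul_sum] at hs ⊢
  linear_combination -hs

theorem energySeq_zero (δ : Derivation F R R) (u : R) : energySeq δ u 0 = -2 := by
  rw [energySeq]

theorem energySeq_one [CharZero F] (δ : Derivation F R R) (u : R) : energySeq δ u 1 = u := by
  have h2 : δ (2 : R) = 0 := by simpa using δ.map_natCast 2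
  have : energySeq δ u 1 = (1 / 16 : F) • ((16 : F) • u) := by
    rw [energySeq]
    rw [Algebra.smul_def (16 : F) u, map_ofNat]
    simp [energySeq_zero, h2]
    ring_nf
  rw [this, smul_smul]
  norm_num

/-- The Lenard recursion. -/
theorem energySeq_lenard [CharZero F] [IsDomain R] (δ : Derivation F R R) (u : R) (n : ℕ) :
    4 * δ (energySeq δ u (n + 1)) = δ (δ (δ (energySeq δ u n))) - 4 * u * δ (energySeq δ u n)
      - 2 * δ u * energySeq δ u n := by
  have h2 : (2 : R) ≠ 0 := by
    rw [← map_ofNat (algebraMap F R) 2]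
    exact (map_ne_zero_iff _ (algebraMap F R).injective).2 two_ne_zero
  have h := deriv_energy δ u (PowerSeries.mk (energySeq δ u))
  have h16 : coeffDeriv δ (16 : R⟦X⟧) = 0 := by simpa using (coeffDeriv δ).map_natCast 16
  rw [energy_energySeq, h16] at h
  -- The factor `-2 w` can be cancelled because its constant term is `4`.
  have hne : -2 * PowerSeries.mk (energySeq δ u) ≠ 0 := by
    intro h0
    have := congrArg (coeff 0) h0
    rw [← map_ofNat C 2, ← map_neg, coeff_C_mul] at this
    simp [energySeq_zero, h2] at this
  have h1 := (mul_eq_zero.1 h.symm).resolve_left hne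
  have h3 : X * (coeffDeriv δ (coeffDeriv δ (coeffDeriv δ (PowerSeries.mk (energySeq δ u))))
      - C (4 * u) * coeffDeriv δ (PowerSeries.mk (energySeq δ u))
      - C (2 * δ u) * PowerSeries.mk (energySeq δ u))
      - C 4 * coeffDeriv δ (PowerSeries.mk (energySeq δ u)) = 0 := by
    rw [← h1, map_mul C, map_mul C, map_ofNat C 2, map_ofNat C 4]
    ring
  have h4 := congrArg (coeff (n + 1)) h3
  simp only [map_sub, coeff_succ_X_mul, coeff_C_mul, coeff_coeffDeriv, coeff_mk, map_zero] at h4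
  linear_combination -h4

/-- The coefficients of the square root of a power series with constant term `1`. -/
def sqrtSeq (m : F⟦X⟧) : ℕ → F
  | 0 => 1
  | n + 1 => (1 / 2) * (coeff (n + 1) m - ∑ i : Fin n, sqrtSeq m (i + 1) * sqrtSeq m (n - i))

theorem sqrtSeq_sq [CharZero F] {m : F⟦X⟧} (hm : constantCoeff m = 1) :
    PowerSeries.mk (sqrtSeq m) ^ 2 = m := by
  ext n
  rw [pow_two, coeff_mul]
  simp only [coeff_mk, Nat.sum_antidiagonal_eq_sum_range_succ_mk]
  rcases n with _ | n
  · simp [sqrtSeq, hm]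
  rw [sum_range_mul_self]
  have h1 : sqrtSeq m (n + 1) = (1 / 2) * (coeff (n + 1) m
      - ∑ i ∈ range n, sqrtSeq m (i + 1) * sqrtSeq m (n - i)) := by
    rw [sqrtSeq, sum_range]
  have h0 : sqrtSeq m 0 = 1 := by rw [sqrtSeq]
  rw [h1, h0]
  ring

end PowerSeriesOverDifferentialRing

end
end KdV

namespace KdV
noncomputable section

open Finset

/-! ### Formal operators and the Lax operators `A_k`. -/

section FormalOperators

variable {F : Type*} [Field F]

/-- The derivation `D F`, bundled as a derivation. -/
def derivD (F : Type*) [Field F] : Derivation F (DiffPoly F) (DiffPoly F) :=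
  MvPolynomial.mkDerivation F (fun j : ℕ => (MvPolynomial.X (j + 1) : DiffPoly F))

theorem derivD_apply (p : DiffPoly F) : derivD F p = D F p := rfl

@[simp]
theorem D_X (j : ℕ) : D F (MvPolynomial.X j) = MvPolynomial.X (j + 1) :=
  MvPolynomial.mkDerivation_X _ _ _

theorem D_mul (p q : DiffPoly F) : D F (p * q) = p * D F q + q * D F p :=
  (derivD F).leibniz p q

@[simp]
theorem D_C (a : F) : D F (MvPolynomial.C a) = 0 :=
  (derivD F).map_algebraMap a

@[simp]
theorem D_one : D F 1 = 0 :=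
  (derivD F).map_one_eq_zero

@[simp]
theorem iterate_D_X (i j : ℕ) : (D F ^ i) (MvPolynomial.X j) = MvPolynomial.X (j + i) := by
  induction i with
  | zero => simp
  | succ i ih => rw [pow_succ', Module.End.mul_apply, ih, D_X, add_assoc]

/-! ### Weights -/

theorem _root_.MvPolynomial.IsWeightedHomogeneous.congr_weight {σ M S : Type*} [CommSemiring S]
    [AddCommMonoid M] {w : σ → M} {p : MvPolynomial σ S} {m n : M}
    (hp : MvPolynomial.IsWeightedHomogeneous w p m) (h : m = n) :
    MvPolynomial.IsWeightedHomogeneous w p n :=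
  h ▸ hp

theorem isWeightedHomogeneous_D {p : DiffPoly F} {n : ℕ}
    (hp : MvPolynomial.IsWeightedHomogeneous (fun j : ℕ => j + 2) p n) :
    MvPolynomial.IsWeightedHomogeneous (fun j : ℕ => j + 2) (D F p) (n + 1) := by
  classical
  rw [p.as_sum, map_sum]
  refine MvPolynomial.IsWeightedHomogeneous.sum _ _ _ fun s hs => ?_
  have hw : Finsupp.weight (fun j : ℕ => j + 2) s = n := hp (MvPolynomial.mem_support_iff.1 hs)
  rw [← derivD_apply, derivD, MvPolynomial.mkDerivation_monomial, MvPolynomial.smul_eq_C_mul]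
  refine MvPolynomial.IsWeightedHomogeneous.C_mul ?_ _
  refine MvPolynomial.IsWeightedHomogeneous.sum _ _ _ fun i hi => ?_
  have hsplit : s = (s - Finsupp.single i 1) + Finsupp.single i 1 := by
    ext j
    by_cases h : i = j
    · subst h
      have : s i ≠ 0 := Finsupp.mem_support_iff.1 hi
      simp
      omega
    · simp [h]
  have hdeg : n + 1 = Finsupp.weight (fun j : ℕ => j + 2) (s - Finsupp.single i 1) + (i + 1 + 2) := by
    rw [← hw]
    conv_lhs => rw [hsplit, map_add, Finsupp.weight_single]
    simp
    ring
  rw [hdeg]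
  exact (MvPolynomial.isWeightedHomogeneous_monomial _ _ _ rfl).mul
    (MvPolynomial.isWeightedHomogeneous_X _ _ _)

/-- The energy is homogeneous of weight `0` once `ξ` has weight `-2`, so each term of the recursion
has the same weight. -/
theorem isWeightedHomogeneous_energySeq (n : ℕ) :
    MvPolynomial.IsWeightedHomogeneous (fun j : ℕ => j + 2)
      (energySeq (derivD F) (MvPolynomial.X 0) n) (2 * n) := by
  have hC : ∀ a : F, MvPolynomial.IsWeightedHomogeneous (fun j : ℕ => j + 2)
      (MvPolynomial.C a : DiffPoly F) 0 := MvPolynomial.isWeightedHomogeneous_C _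
  have h2 : (2 : DiffPoly F) = MvPolynomial.C 2 := (map_ofNat MvPolynomial.C 2).symm
  have h4 : (4 : DiffPoly F) = MvPolynomial.C 4 := (map_ofNat MvPolynomial.C 4).symm
  induction n using Nat.strong_induction_on with
  | _ n ih =>
  rcases n with _ | n
  · rw [energySeq_zero, h2, ← map_neg]
    exact hC _
  · rw [energySeq, MvPolynomial.smul_eq_C_mul, h2, h4]
    refine MvPolynomial.IsWeightedHomogeneous.C_mul (.add ?_ (.C_mul ?_ _)) _
    · refine MvPolynomial.IsWeightedHomogeneous.sum _ _ _ fun i _ => ?_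
      have e1 := ih i i.2
      have e2 := ih (n - i) (by omega)
      have hi : (i : ℕ) ≤ n := Nat.lt_succ_iff.1 i.2
      refine .add (.sub ?_ ?_) ?_
      · exact ((isWeightedHomogeneous_D e1).mul (isWeightedHomogeneous_D e2)).congr_weight
          (by omega)
      · exact (((isWeightedHomogeneous_D (isWeightedHomogeneous_D e1)).C_mul 2).mul
          e2).congr_weight (by omega)
      · exact (((MvPolynomial.isWeightedHomogeneous_X F (fun j : ℕ => j + 2) 0).C_mul 4).mul
          (e1.mul e2)).congr_weight (by omega)
    · refine MvPolynomial.IsWeightedHomogeneous.sum _ _ _ fun i _ => ?_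
      have hi : (i : ℕ) < n := i.2
      exact ((ih (i + 1) (by omega)).mul (ih (n - i) (by omega))).congr_weight (by omega)

/-! ### Realization of formal operators -/

section Realize

variable {R : Type*} [CommRing R] [Algebra F R] (δ : Derivation F R R) (φ : DiffPoly F →ₐ[F] R)

/-- The operator on `R` given by a formal operator, where `∂` acts as the derivation `δ` and the
coefficients act through the homomorphism `φ`. -/
def realize (c : FormalOp F) : Module.End F R :=
  c.sum fun i p => LinearMap.mulLeft F (φ p) * (δ : R →ₗ[F] R) ^ i

/-- Statements on `realize` thereby serve twice: for formal operators and for their values at an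
actual function. -/
theorem toEnd_eq_realize (c : FormalOp F) :
    c.toEnd = realize (derivD F) (AlgHom.id F (DiffPoly F)) c := rfl

@[simp]
theorem realize_zero : realize δ φ 0 = 0 := Finsupp.sum_zero_index

@[simp]
theorem realize_single (i : ℕ) (p : DiffPoly F) :
    realize δ φ (Finsupp.single i p) = LinearMap.mulLeft F (φ p) * (δ : R →ₗ[F] R) ^ i :=
  Finsupp.sum_single_index (by simp)

theorem realize_add (c e : FormalOp F) : realize δ φ (c + e) = realize δ φ c + realize δ φ e :=
  Finsupp.sum_add_index' (by simp) (fun i p q => by ext; simp [add_mul])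

theorem realize_smul (p : DiffPoly F) (c : FormalOp F) :
    realize δ φ (p • c) = LinearMap.mulLeft F (φ p) * realize δ φ c := by
  induction c using Finsupp.induction_linear with
  | zero => simp
  | add c e hc he => rw [smul_add, realize_add, realize_add, hc, he, mul_add]
  | single i q =>
    rw [Finsupp.smul_single, realize_single, realize_single, smul_eq_mul, map_mul,
      LinearMap.mulLeft_mul, ← Module.End.mul_eq_comp, mul_assoc]

theorem realize_sub (c e : FormalOp F) : realize δ φ (c - e) = realize δ φ c - realize δ φ e := by
  have h := realize_add δ φ (c - e) e
  rw [sub_add_cancel] at h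
  rw [h, add_sub_cancel_right]

theorem conj_zero : (0 : FormalOp F).conj = 0 := Finsupp.sum_zero_index

theorem conj_single (i : ℕ) (p : DiffPoly F) :
    FormalOp.conj (Finsupp.single i p) = (-D F) ^ i * LinearMap.mulLeft F p :=
  Finsupp.sum_single_index (by simp)

theorem conj_add (c e : FormalOp F) : (c + e).conj = c.conj + e.conj :=
  Finsupp.sum_add_index' (by simp) (fun i p q => by ext; simp [add_mul])

theorem conj_sub (c e : FormalOp F) : (c - e).conj = c.conj - e.conj := by
  have h := conj_add (c - e) e
  rw [sub_add_cancel] at h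
  rw [h, add_sub_cancel_right]

theorem conj_smul (p : DiffPoly F) (c : FormalOp F) :
    (p • c).conj = c.conj * LinearMap.mulLeft F p := by
  induction c using Finsupp.induction_linear with
  | zero => simp [conj_zero]
  | add c e hc he => rw [smul_add, conj_add, conj_add, hc, he, add_mul]
  | single i q =>
    rw [Finsupp.smul_single, conj_single, conj_single, smul_eq_mul, mul_comm,
      LinearMap.mulLeft_mul, ← Module.End.mul_eq_comp, mul_assoc]

/-- The formal operator `c ∘ ∂`. -/
def shiftOp (c : FormalOp F) : FormalOp F := c.mapDomain Nat.succ

theorem shiftOp_add (c e : FormalOp F) : shiftOp (c + e) = shiftOp c + shiftOp e :=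
  Finsupp.mapDomain_add

theorem shiftOp_single (i : ℕ) (p : DiffPoly F) :
    shiftOp (Finsupp.single i p) = Finsupp.single (i + 1) p :=
  Finsupp.mapDomain_single

@[simp]
theorem shiftOp_apply_succ (c : FormalOp F) (i : ℕ) : shiftOp c (i + 1) = c i :=
  Finsupp.mapDomain_apply Nat.succ_injective c i

@[simp]
theorem shiftOp_apply_zero (c : FormalOp F) : shiftOp c 0 = 0 :=
  Finsupp.mapDomain_of_notMem_range c 0 (by simp)

theorem realize_shiftOp (c : FormalOp F) :
    realize δ φ (shiftOp c) = realize δ φ c * (δ : R →ₗ[F] R) := by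
  induction c using Finsupp.induction_linear with
  | zero => simp [shiftOp]
  | add c e hc he => rw [shiftOp_add, realize_add, realize_add, hc, he, add_mul]
  | single i q => rw [shiftOp_single, realize_single, realize_single, pow_succ, mul_assoc]

theorem conj_shiftOp (c : FormalOp F) : (shiftOp c).conj = -D F * c.conj := by
  induction c using Finsupp.induction_linear with
  | zero => simp [shiftOp, conj_zero]
  | add c e hc he => rw [shiftOp_add, conj_add, conj_add, hc, he, mul_add]
  | single i q => rw [shiftOp_single, conj_single, conj_single, pow_succ', mul_assoc]

/-- The formal operator `∂^i ∘ f`. -/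
def powMul : ℕ → DiffPoly F → FormalOp F
  | 0, f => Finsupp.single 0 f
  -- Leibniz: `∂ ∘ f = f ∘ ∂ + f'`, with `∂^i` kept on the left.
  | i + 1, f => shiftOp (powMul i f) + powMul i (D F f)

variable {δ φ} in
theorem realize_powMul (hφ : ∀ p, φ (D F p) = δ (φ p)) (i : ℕ) (f : DiffPoly F) :
    realize δ φ (powMul i f) = (δ : R →ₗ[F] R) ^ i * LinearMap.mulLeft F (φ f) := by
  induction i generalizing f with
  | zero => simp [powMul]
  | succ i ih =>
    rw [powMul, realize_add, realize_shiftOp, ih, ih, pow_succ, mul_assoc, ← mul_add, mul_assoc,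
      hφ]
    congr 1
    ext x
    simp [Derivation.leibniz, mul_comm, add_comm]

/-- `FormalOp.conj` is defined on operators written with coefficients on the left, so its
anti-multiplicativity has to be proved; this is the case of `∂^i ∘ f`. -/
theorem conj_powMul (i : ℕ) (f : DiffPoly F) :
    (powMul i f).conj = LinearMap.mulLeft F f * (-D F) ^ i := by
  induction i generalizing f with
  | zero => simp [powMul, conj_single]
  | succ i ih =>
    rw [powMul, conj_add, conj_shiftOp, ih, ih, pow_succ', ← mul_assoc, ← mul_assoc, ← add_mul]
    congr 1
    ext x
    simp [D_mul, mul_comm]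

/-- The formal operator `c ∘ (∂² - u)`. -/
def mulSchrodinger (c : FormalOp F) : FormalOp F :=
  c.sum fun i p => Finsupp.single (i + 2) p - p • powMul i (MvPolynomial.X 0)

theorem mulSchrodinger_single (i : ℕ) (p : DiffPoly F) :
    mulSchrodinger (Finsupp.single i p) =
      Finsupp.single (i + 2) p - p • powMul i (MvPolynomial.X 0) :=
  Finsupp.sum_single_index (by simp)

theorem mulSchrodinger_add (c e : FormalOp F) :
    mulSchrodinger (c + e) = mulSchrodinger c + mulSchrodinger e :=
  Finsupp.sum_add_index' (by simp) (fun i p q => by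
    rw [Finsupp.single_add, add_smul]; abel)

variable {δ φ} in
theorem realize_mulSchrodinger (hφ : ∀ p, φ (D F p) = δ (φ p)) (c : FormalOp F) :
    realize δ φ (mulSchrodinger c) = realize δ φ c *
      ((δ : R →ₗ[F] R) ^ 2 - LinearMap.mulLeft F (φ (MvPolynomial.X 0))) := by
  induction c using Finsupp.induction_linear with
  | zero => simp [mulSchrodinger]
  | add c e hc he => rw [mulSchrodinger_add, realize_add, realize_add, hc, he, add_mul]
  | single i q =>
    rw [mulSchrodinger_single, realize_sub, realize_single, realize_single, realize_smul,
      realize_powMul hφ, pow_add, mul_sub]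
    simp only [mul_assoc]

/-- `∂² - u` is symmetric, so conjugation moves it from the right to the left. -/
theorem conj_mulSchrodinger (c : FormalOp F) :
    (mulSchrodinger c).conj = formalL F * c.conj := by
  induction c using Finsupp.induction_linear with
  | zero => simp [mulSchrodinger, conj_zero]
  | add c e hc he => rw [mulSchrodinger_add, conj_add, conj_add, hc, he, mul_add]
  | single i q =>
    rw [mulSchrodinger_single, conj_sub, conj_single, conj_single, conj_smul,
      conj_powMul, add_comm i 2, pow_add, formalL, sub_mul,
      show (-D F) ^ 2 = D F ^ 2 from LinearMap.ext fun x => by simp [pow_two]]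
    simp only [mul_assoc]

end Realize

/-! ### Homogeneous operators -/

/-- `c` is homogeneous of degree `d`. -/
def IsHomogeneousOp (d : ℕ) (c : FormalOp F) : Prop :=
  ∀ i, (i ≤ d → MvPolynomial.IsWeightedHomogeneous (fun j : ℕ => j + 2) (c i) (d - i)) ∧
    (d < i → c i = 0)

theorem IsHomogeneousOp.add {d : ℕ} {c e : FormalOp F} (hc : IsHomogeneousOp d c)
    (he : IsHomogeneousOp d e) : IsHomogeneousOp d (c + e) := fun i =>
  ⟨fun h => ((hc i).1 h).add ((he i).1 h), fun h => by simp [(hc i).2 h, (he i).2 h]⟩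

theorem IsHomogeneousOp.sub {d : ℕ} {c e : FormalOp F} (hc : IsHomogeneousOp d c)
    (he : IsHomogeneousOp d e) : IsHomogeneousOp d (c - e) := fun i =>
  ⟨fun h => ((hc i).1 h).sub ((he i).1 h), fun h => by simp [(hc i).2 h, (he i).2 h]⟩

theorem isHomogeneousOp_single {i d e : ℕ} {p : DiffPoly F}
    (hp : MvPolynomial.IsWeightedHomogeneous (fun j : ℕ => j + 2) p e) (h : i + e = d) :
    IsHomogeneousOp d (Finsupp.single i p) := by
  intro j
  subst h
  refine ⟨fun hj => ?_, fun hj => Finsupp.single_eq_of_ne (by omega)⟩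
  by_cases hij : i = j
  · subst hij
    simpa using hp
  · rw [Finsupp.single_eq_of_ne (by omega)]
    exact MvPolynomial.isWeightedHomogeneous_zero _ _ _

theorem IsHomogeneousOp.smul {d e : ℕ} {p : DiffPoly F} {c : FormalOp F}
    (hp : MvPolynomial.IsWeightedHomogeneous (fun j : ℕ => j + 2) p e)
    (hc : IsHomogeneousOp d c) : IsHomogeneousOp (e + d) (p • c) := by
  intro j
  rw [Finsupp.smul_apply, smul_eq_mul]
  refine ⟨fun hj => ?_, fun hj => by rw [(hc j).2 (by omega), mul_zero]⟩
  by_cases hjd : j ≤ d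
  · exact (hp.mul ((hc j).1 hjd)).congr_weight (by omega)
  · rw [(hc j).2 (by omega), mul_zero]
    exact MvPolynomial.isWeightedHomogeneous_zero _ _ _

theorem IsHomogeneousOp.shiftOp {d : ℕ} {c : FormalOp F} (hc : IsHomogeneousOp d c) :
    IsHomogeneousOp (d + 1) (shiftOp c) := by
  intro j
  rcases j with _ | j
  · simpa using MvPolynomial.isWeightedHomogeneous_zero F (fun j : ℕ => j + 2) _
  · simpa using hc j

theorem isHomogeneousOp_powMul {e : ℕ} {f : DiffPoly F}
    (hf : MvPolynomial.IsWeightedHomogeneous (fun j : ℕ => j + 2) f e) (i : ℕ) :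
    IsHomogeneousOp (e + i) (powMul i f) := by
  induction i generalizing e f with
  | zero => exact isHomogeneousOp_single hf (by omega)
  | succ i ih =>
    refine (ih hf).shiftOp.add ?_
    convert ih (isWeightedHomogeneous_D hf) using 1
    omega

theorem powMul_apply_of_lt (f : DiffPoly F) {i j : ℕ} (h : i < j) : powMul i f j = 0 := by
  induction i generalizing f j with
  | zero => exact Finsupp.single_eq_of_ne (by omega)
  | succ i ih =>
    obtain ⟨j, rfl⟩ : ∃ k, j = k + 1 := ⟨j - 1, by omega⟩
    simp [powMul, ih f (show i < j by omega), ih (D F f) (show i < j + 1 by omega)]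

theorem isHomogeneousOp_mulSchrodinger {d : ℕ} {c : FormalOp F} (hc : IsHomogeneousOp d c) :
    IsHomogeneousOp (d + 2) (mulSchrodinger c) := by
  have hsum : ∀ (s : Finset ℕ) (f : ℕ → FormalOp F),
      (∀ i ∈ s, IsHomogeneousOp (d + 2) (f i)) → IsHomogeneousOp (d + 2) (∑ i ∈ s, f i) := by
    intro s f h
    refine Finset.sum_induction f _ (fun _ _ => IsHomogeneousOp.add) ?_ h
    exact fun j => ⟨fun _ => MvPolynomial.isWeightedHomogeneous_zero _ _ _, fun _ => rfl⟩
  refine hsum _ _ fun i hi => ?_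
  have hid : i ≤ d := by
    by_contra h
    exact Finsupp.mem_support_iff.1 hi ((hc i).2 (by omega))
  refine (isHomogeneousOp_single ((hc i).1 hid) (by omega)).sub ?_
  convert IsHomogeneousOp.smul ((hc i).1 hid)
    (isHomogeneousOp_powMul (MvPolynomial.isWeightedHomogeneous_X F (fun j : ℕ => j + 2) 0) i)
    using 1
  omega

theorem mulSchrodinger_apply_top {d : ℕ} {c : FormalOp F} (hc : IsHomogeneousOp d c) :
    mulSchrodinger c (d + 2) = c d := by
  rw [mulSchrodinger, Finsupp.sum_apply, Finsupp.sum, Finset.sum_eq_single d]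
  · simp [powMul_apply_of_lt _ (show d < d + 2 by omega)]
  · intro i hi hid
    have : i ≤ d := by
      by_contra h
      exact Finsupp.mem_support_iff.1 hi ((hc i).2 (by omega))
    simp [powMul_apply_of_lt _ (show i < d + 2 by omega), hid]
  · intro h
    simp [Finsupp.notMem_support_iff.1 h]

/-! ### Uniqueness of Lax operators -/

/-- Every differential polynomial is independent of `u^(j)` for all large `j`. -/
theorem exists_pderiv_eq_zero (p : DiffPoly F) :
    ∃ N, ∀ j, N ≤ j → MvPolynomial.pderiv j p = 0 := by
  refine ⟨p.vars.sup id + 1, fun j hj => MvPolynomial.pderiv_eq_zero_of_notMem_vars fun h => ?_⟩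
  have := Finset.le_sup (f := id) h
  simp only [id] at this
  omega

theorem pderiv_succ_D (j : ℕ) (p : DiffPoly F) :
    MvPolynomial.pderiv (j + 1) (D F p) =
      D F (MvPolynomial.pderiv (j + 1) p) + MvPolynomial.pderiv j p := by
  classical
  induction p using MvPolynomial.induction_on with
  | C a => simp
  | add p q hp hq => simp only [map_add, hp, hq]; ring
  | mul_X p i hp =>
    simp only [D_mul, Derivation.leibniz, map_add, hp, D_X, smul_eq_mul, MvPolynomial.pderiv_X,
      Pi.single_apply, add_left_inj]
    by_cases h1 : i = j <;> by_cases h2 : i = j + 1 <;> simp [h1, h2, D_one] <;> ring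

/-- Since `[∂/∂u^(j+1), D] = ∂/∂u^(j)`, on the kernel of `D` vanishing passes from index `j + 1`
down to `j`; for large indices it is automatic. -/
theorem pderiv_eq_zero_of_D_eq_zero {p : DiffPoly F} (h : D F p = 0) (j : ℕ) :
    MvPolynomial.pderiv j p = 0 := by
  obtain ⟨N, hN⟩ := exists_pderiv_eq_zero p
  have step : ∀ i, MvPolynomial.pderiv (i + 1) p = 0 → MvPolynomial.pderiv i p = 0 := by
    intro i hi
    have := pderiv_succ_D i p
    rw [h, hi] at this
    simpa using this.symm
  rcases le_total N j with h1 | h1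
  · exact hN j h1
  · exact Nat.decreasingInduction' (P := fun i => MvPolynomial.pderiv i p = 0)
      (fun i _ _ hi => step i hi) h1 (hN N le_rfl)

/-- In characteristic zero the kernel of `D` consists of constants, and positive weight excludes the
nonzero ones. -/
theorem eq_zero_of_D_eq_zero [CharZero F] {p : DiffPoly F} {n : ℕ} (hn : n ≠ 0)
    (hp : MvPolynomial.IsWeightedHomogeneous (fun j : ℕ => j + 2) p n) (h : D F p = 0) :
    p = 0 := by
  classical
  ext s
  rw [MvPolynomial.coeff_zero]
  by_contra hs
  have hw := hp hs
  obtain ⟨i, hi⟩ : ∃ i, s i ≠ 0 := by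
    by_contra! h0
    obtain rfl : s = 0 := Finsupp.ext h0
    simp at hw
    exact hn hw.symm
  have h1 := congrArg (MvPolynomial.coeff (s - Finsupp.single i 1)) (pderiv_eq_zero_of_D_eq_zero h i)
  rw [MvPolynomial.coeff_zero, MvPolynomial.coeff_pderiv,
    tsub_add_cancel_of_le (Finsupp.single_le_iff.2 (Nat.one_le_iff_ne_zero.2 hi))] at h1
  refine (mul_ne_zero hs ?_) h1
  exact Nat.cast_add_one_ne_zero _

theorem pderiv_iterate_D_mul_X {N i j : ℕ} (h : N + i < j) :
    MvPolynomial.pderiv j ((D F ^ i) (MvPolynomial.X 0 * MvPolynomial.X N)) = 0 := by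
  classical
  have key : ∀ (i : ℕ) (j : ℕ), N + i < j → MvPolynomial.pderiv j
      ((D F ^ i) (MvPolynomial.X 0 * MvPolynomial.X N)) = 0 := by
    intro i
    induction i with
    | zero =>
      intro j hj
      simp [Derivation.leibniz, MvPolynomial.pderiv_X,
        show N ≠ j by omega, show 0 ≠ j by omega]
    | succ i ih =>
      intro j hj
      obtain ⟨k, rfl⟩ : ∃ k, j = k + 1 := ⟨j - 1, by omega⟩
      rw [pow_succ', Module.End.mul_apply, pderiv_succ_D, ih _ (by omega), ih _ (by omega)]
      simp
  exact key i j h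

/-- A homogeneous operator of degree `d`, order less than `d`, whose commutator with `∂² - u` is a
multiplication operator, vanishes. -/
theorem eq_zero_of_commutator_eq_mulLeft [CharZero F] {d : ℕ} {c : FormalOp F}
    (hc : IsHomogeneousOp d c) (hd : c d = 0) {r : DiffPoly F}
    (hr : c.toEnd * formalL F - formalL F * c.toEnd = LinearMap.mulLeft F r) : c = 0 := by
  classical
  by_contra hne
  have hsupp : c.support.Nonempty := Finsupp.support_nonempty_iff.2 hne
  set n := c.support.max' hsupp with hn
  have hnmem : n ∈ c.support := c.support.max'_mem hsupp
  have hle : ∀ i ∈ c.support, i ≤ n := fun i hi => c.support.le_max' i hi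
  have hcn : c n ≠ 0 := Finsupp.mem_support_iff.1 hnmem
  have hnd : n < d := by
    rcases lt_trichotomy n d with h | h | h
    · exact h
    · exact absurd (h ▸ hd) hcn
    · exact absurd ((hc n).2 h) hcn
  -- For `N` beyond every variable of `r`, the coefficients and their first two derivatives, `u^(N)`
  -- behaves as an independent test function.
  choose B hB using fun p : DiffPoly F => exists_pderiv_eq_zero p
  set N := B r + ∑ i ∈ c.support, (B (c i) + B (D F (c i)) + B (D F (D F (c i)))) + 1 with hN
  have hbd : ∀ i ∈ c.support, B (c i) + B (D F (c i)) + B (D F (D F (c i))) ≤ N := by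
    intro i hi
    have := Finset.single_le_sum
      (f := fun i => B (c i) + B (D F (c i)) + B (D F (D F (c i)))) (fun _ _ => Nat.zero_le _) hi
    omega
  have happ : ∀ p : DiffPoly F, c.toEnd p = ∑ i ∈ c.support, c i * (D F ^ i) p := by
    intro p
    simp [FormalOp.toEnd, Finsupp.sum]
  have h1 := congrArg (fun T : Module.End F (DiffPoly F) => T (MvPolynomial.X N)) hr
  simp only [LinearMap.sub_apply, Module.End.mul_apply, formalL, LinearMap.mulLeft_apply, pow_two,
    happ, D_X, mul_sub, map_sum, iterate_D_X, D_mul, map_add] at h1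
  -- With `n` the order of `c`, this extracts the coefficient of `u^(N+n+1)`: the symbol of order `n
  -- + 1` of the commutator, equal to `-2 (c n)'`.
  have h2 := congrArg (MvPolynomial.pderiv (N + n + 1)) h1
  rw [← Finset.sum_sub_distrib, ← Finset.sum_sub_distrib, map_sum,
    Derivation.leibniz, hB r _ (by omega), smul_zero,
    MvPolynomial.pderiv_X_of_ne (show N ≠ N + n + 1 by omega), smul_zero, add_zero] at h2
  have h3 : ∀ i ∈ c.support, MvPolynomial.pderiv (N + n + 1)
      (c i * MvPolynomial.X (N + 1 + 1 + i) - c i * (D F ^ i) (MvPolynomial.X 0 * MvPolynomial.X N)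
        - (c i * MvPolynomial.X (N + i + 1 + 1) + MvPolynomial.X (N + i + 1) * D F (c i)
          + (MvPolynomial.X (N + i) * D F (D F (c i)) + D F (c i) * MvPolynomial.X (N + i + 1))
          - MvPolynomial.X 0 * (c i * MvPolynomial.X (N + i)))) =
      if i = n then -2 * D F (c n) else 0 := by
    intro i hi
    have b := hbd i hi
    have hin := hle i hi
    have e : N + 1 + 1 + i = N + i + 1 + 1 := by omega
    rw [e]
    have hX : MvPolynomial.pderiv (N + n + 1) (MvPolynomial.X (N + i + 1) : DiffPoly F) =
        if i = n then 1 else 0 := by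
      simp [MvPolynomial.pderiv_X, Pi.single_apply]
    simp only [map_sub, map_add, Derivation.leibniz, smul_eq_mul, hX,
      hB (c i) (N + n + 1) (by omega), hB (D F (c i)) (N + n + 1) (by omega),
      hB (D F (D F (c i))) (N + n + 1) (by omega),
      pderiv_iterate_D_mul_X (F := F) (show N + i < N + n + 1 by omega),
      MvPolynomial.pderiv_X_of_ne (show N + i ≠ N + n + 1 by omega),
      MvPolynomial.pderiv_X_of_ne (show 0 ≠ N + n + 1 by omega)]
    split_ifs with h
    · subst h; ring
    · ring
  rw [Finset.sum_congr rfl h3, Finset.sum_ite_eq' , if_pos hnmem] at h2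
  have h4 : D F (c n) = 0 := by
    have h22 : (-2 : DiffPoly F) ≠ 0 := by
      rw [← map_ofNat MvPolynomial.C 2, ← map_neg]
      exact MvPolynomial.C_ne_zero.2 (by norm_num)
    exact (mul_eq_zero.1 h2).resolve_left h22
  exact hcn (eq_zero_of_D_eq_zero (n := d - n) (by omega) ((hc n).1 hnd.le) h4)

/-! ### Construction of Lax operators -/

/-- The coefficients `w_j` with `r_k = -w_{k+1}'`, normalised by `w_0 = -2`, `w_1 = u`. -/
def lenard (F : Type*) [Field F] (n : ℕ) : DiffPoly F :=
  energySeq (derivD F) (MvPolynomial.X 0) n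

/-- The formal operator `∑_{j ≤ k} (-w_j ∂ / 2 + w_j' / 4) (∂² - u)^(k-j)`. -/
def lenardOp (F : Type*) [Field F] : ℕ → FormalOp F
  | 0 => Finsupp.single 1 1
  | k + 1 => mulSchrodinger (lenardOp F k)
      + (Finsupp.single 1 (MvPolynomial.C (-1 / 2) * lenard F (k + 1))
        + Finsupp.single 0 (MvPolynomial.C (1 / 4) * D F (lenard F (k + 1))))

theorem toEnd_lenardOp_succ (k : ℕ) :
    (lenardOp F (k + 1)).toEnd = (lenardOp F k).toEnd * formalL F
      + (LinearMap.mulLeft F (MvPolynomial.C (-1 / 2) * lenard F (k + 1)) * D F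
        + LinearMap.mulLeft F (MvPolynomial.C (1 / 4) * D F (lenard F (k + 1)))) := by
  have h := realize_mulSchrodinger (δ := derivD F) (φ := AlgHom.id F (DiffPoly F))
    (fun _ => rfl) (lenardOp F k)
  rw [lenardOp, toEnd_eq_realize, realize_add, realize_add, realize_single, realize_single, h,
    pow_one, pow_zero, mul_one]
  rfl

theorem commutator_mul_add_commutator {A : Type*} [Ring A] (a l p : A) :
    (a * l + p) * l - l * (a * l + p) = (a * l - l * a) * l + (p * l - l * p) := by
  noncomm_ring

theorem commutator_sub {A : Type*} [Ring A] (a b l : A) :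
    (a - b) * l - l * (a - b) = (a * l - l * a) - (b * l - l * b) := by
  noncomm_ring

/-- The Lenard recursion in operator form: with `q = 1/4` and `B(w) = -w ∂ / 2 + w' / 4`, it says
`[B(w), L] = w' L - w₁'`. -/
theorem first_order_commutator {R : Type*} [CommRing R] [Algebra F R] (δ : Derivation F R R)
    {q u w w₁ : R} (hq : 4 * q = 1) (hδq : δ q = 0)
    (hrec : 4 * δ w₁ = δ (δ (δ w)) - 4 * u * δ w - 2 * δ u * w) (x : R) :
    -δ w * (δ (δ x) - u * x) + (-2 * q * w * δ (δ (δ x) - u * x) + q * δ w * (δ (δ x) - u * x)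
      - (δ (δ (-2 * q * w * δ x + q * δ w * x)) - u * (-2 * q * w * δ x + q * δ w * x))) =
    -δ w₁ * x := by
  have h2 : δ 2 = 0 := by simpa using δ.map_natCast 2
  simp only [map_add, map_sub, map_neg, Derivation.leibniz, smul_eq_mul, hδq, h2, map_zero]
  linear_combination (δ w * δ (δ x) - δ w * (u * x) - δ w₁ * x) * hq + q * x * hrec

/-- Induction on `[A_{k+1}, L] = [A_k, L] L + [B(w_{k+1}), L]`: the terms `∓ w_{k+1}' L` cancel and
`-w_{k+2}'` remains. -/
theorem commutator_lenardOp [CharZero F] (k : ℕ) :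
    (lenardOp F k).toEnd * formalL F - formalL F * (lenardOp F k).toEnd =
      LinearMap.mulLeft F (-D F (lenard F (k + 1))) := by
  induction k with
  | zero =>
    have h1 : lenard F (0 + 1) = MvPolynomial.X 0 := energySeq_one _ _
    have h0 : (lenardOp F 0).toEnd = D F := by
      rw [lenardOp, toEnd_eq_realize, realize_single]
      refine LinearMap.ext fun x => ?_
      simp [derivD_apply]
    rw [h1, h0]
    refine LinearMap.ext fun x => ?_
    simp [formalL, pow_two, D_mul]
    ring
  | succ k ih =>
    have h4 : (MvPolynomial.C (1 / 4 : F) : DiffPoly F) * 4 = 1 := by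
      rw [← map_ofNat MvPolynomial.C 4, ← MvPolynomial.C_mul]; norm_num
    have hh : (MvPolynomial.C (-1 / 2 : F) : DiffPoly F) = -2 * MvPolynomial.C (1 / 4 : F) := by
      rw [← map_ofNat MvPolynomial.C 2, ← map_neg, ← MvPolynomial.C_mul]; norm_num
    have hrec : 4 * derivD F (lenard F (k + 1 + 1)) = derivD F (derivD F (derivD F (lenard F (k + 1))))
        - 4 * MvPolynomial.X 0 * derivD F (lenard F (k + 1))
        - 2 * derivD F (MvPolynomial.X 0) * lenard F (k + 1) :=
      energySeq_lenard (derivD F) (MvPolynomial.X 0) (k + 1)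
    rw [toEnd_lenardOp_succ, commutator_mul_add_commutator, ih, hh]
    refine LinearMap.ext fun x => ?_
    have := first_order_commutator (derivD F) (mul_comm _ _ |>.trans h4) (D_C _) hrec x
    simpa [formalL, pow_two, derivD_apply, sub_mul, add_mul, mul_assoc] using this

/-- Conjugating `A_k L + B(w_{k+1})` gives `-L A_k + B*`. Both `L A_k - A_k L` and `B + B*` are
multiplication by `w_{k+1}'`, so the two corrections cancel. -/
theorem conj_lenardOp [CharZero F] (k : ℕ) : (lenardOp F k).conj = -(lenardOp F k).toEnd := by
  induction k with
  | zero =>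
    rw [lenardOp, toEnd_eq_realize, realize_single, conj_single]
    refine LinearMap.ext fun x => ?_
    simp
    rfl
  | succ k ih =>
    have hh : (MvPolynomial.C (1 / 4 : F) : DiffPoly F) * 4 = 1 := by
      rw [← map_ofNat MvPolynomial.C 4, ← MvPolynomial.C_mul]; norm_num
    have h2 : (MvPolynomial.C (-1 / 2 : F) : DiffPoly F) = -2 * MvPolynomial.C (1 / 4 : F) := by
      rw [← map_ofNat MvPolynomial.C 2, ← map_neg, ← MvPolynomial.C_mul]; norm_num
    have hD2 : D F 2 = 0 := (derivD F).map_natCast 2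
    have hc := commutator_lenardOp (F := F) k
    rw [sub_eq_iff_eq_add] at hc
    rw [toEnd_lenardOp_succ, hc, lenardOp, conj_add, conj_mulSchrodinger, ih, conj_add, conj_single,
      conj_single, pow_one, pow_zero, one_mul, h2]
    refine LinearMap.ext fun x => ?_
    simp only [LinearMap.add_apply, LinearMap.neg_apply, Module.End.mul_apply,
      LinearMap.mulLeft_apply, map_neg, D_mul, hD2, D_C]
    linear_combination (x * D F (lenard F (k + 1))) * hh

theorem isHomogeneousOp_lenardOp (k : ℕ) : IsHomogeneousOp (2 * k + 1) (lenardOp F k) := by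
  induction k with
  | zero => exact isHomogeneousOp_single (MvPolynomial.isWeightedHomogeneous_one _ _) rfl
  | succ k ih =>
    refine (isHomogeneousOp_mulSchrodinger ih).add (.add ?_ ?_)
    · exact isHomogeneousOp_single ((isWeightedHomogeneous_energySeq (k + 1)).C_mul _) (by omega)
    · exact isHomogeneousOp_single
        ((isWeightedHomogeneous_D (isWeightedHomogeneous_energySeq (k + 1))).C_mul _) (by omega)

theorem lenardOp_apply_top (k : ℕ) : lenardOp F k (2 * k + 1) = 1 := by
  induction k with
  | zero => simp [lenardOp]
  | succ k ih =>
    rw [lenardOp, Finsupp.add_apply, Finsupp.add_apply,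
      Finsupp.single_eq_of_ne (by omega), Finsupp.single_eq_of_ne (by omega),
      show 2 * (k + 1) + 1 = 2 * k + 1 + 2 by ring,
      mulSchrodinger_apply_top (isHomogeneousOp_lenardOp k), ih]
    simp

theorem isLaxOperator_lenardOp [CharZero F] (k : ℕ) : IsLaxOperator k (lenardOp F k) where
  leading := lenardOp_apply_top k
  order_le i hi := (isHomogeneousOp_lenardOp k i).2 hi
  homogeneous i hi := (isHomogeneousOp_lenardOp k i).1 hi
  antisymmetric := conj_lenardOp k
  commutator := ⟨_, commutator_lenardOp k⟩

/-- The difference is homogeneous of degree `2k+1` with zero top coefficient and its commutator with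
`L` is a function, so it vanishes. -/
theorem laxOperator_eq_lenardOp [CharZero F] (k : ℕ) : laxOperator F k = lenardOp F k := by
  have h1 : IsLaxOperator k (laxOperator F k) :=
    Classical.epsilon_spec ⟨_, isLaxOperator_lenardOp k⟩
  have h2 := isLaxOperator_lenardOp (F := F) k
  obtain ⟨r, hr⟩ := h1.commutator
  obtain ⟨s, hs⟩ := h2.commutator
  have hom : IsHomogeneousOp (2 * k + 1) (laxOperator F k) := fun i =>
    ⟨h1.homogeneous i, h1.order_le i⟩
  have top : (laxOperator F k - lenardOp F k) (2 * k + 1) = 0 := by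
    rw [Finsupp.sub_apply, h1.leading, h2.leading, sub_self]
  have e : (laxOperator F k - lenardOp F k).toEnd =
      (laxOperator F k).toEnd - (lenardOp F k).toEnd :=
    realize_sub (derivD F) (AlgHom.id F (DiffPoly F)) _ _
  refine sub_eq_zero.1 (eq_zero_of_commutator_eq_mulLeft (r := r - s)
    (hom.sub (isHomogeneousOp_lenardOp k)) top ?_)
  rw [e, commutator_sub, hr, hs]
  exact LinearMap.ext fun x => (sub_mul r s x).symm

theorem kdvPoly_eq [CharZero F] (k : ℕ) : kdvPoly F k = -D F (lenard F (k + 1)) := by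
  rw [kdvPoly, laxOperator_eq_lenardOp, commutator_lenardOp]
  simp

end FormalOperators

end
end KdV

namespace KdV
noncomputable section

open PowerSeries Finset

/-! ### What commutativity of the operators says about the potentials. -/

section CommutingDerivations

variable {F R : Type*} [Field F] [CommRing R] [Algebra F R]

theorem derivation_two (δ : Derivation F R R) : δ 2 = 0 := by
  simpa using δ.map_natCast 2

theorem derivation_four (δ : Derivation F R R) : δ 4 = 0 := by
  simpa using δ.map_natCast 4

theorem eq_zero_of_natCast_mul (F : Type*) {R : Type*} [Field F] [CharZero F] [CommRing R]
    [Algebra F R] {n : ℕ} (hn : n ≠ 0) {r : R} (h : (n : R) * r = 0) : r = 0 := by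
  have h1 : (n : F) • r = 0 := by
    rw [Algebra.smul_def, map_natCast]
    exact h
  exact (smul_eq_zero_iff_right (Nat.cast_ne_zero.2 hn)).1 h1

/-! ### Consequences of commutativity -/

/-- `∂² - u`. -/
def schrodinger (δ : Derivation F R R) (u : R) : Module.End F R :=
  (δ : R →ₗ[F] R) ^ 2 - LinearMap.mulLeft F u

@[simp]
theorem schrodinger_apply (δ : Derivation F R R) (u f : R) :
    schrodinger δ u f = δ (δ f) - u * f := by
  simp [schrodinger, pow_two]

/-- Four times the operator `∂²ε - (u ε + ε u) / 2 - (p ∂ + ∂ p) / 4 - ζ`. -/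
def flowOp (δ ε ζ : Derivation F R R) (u p f : R) : R :=
  4 * δ (δ (ε f)) - 2 * (u * ε f + ε (u * f)) - (p * δ f + δ (p * f)) - 4 * ζ f

variable [CharZero F]

theorem relations_of_commute_schrodinger {δ ε ζ : Derivation F R R} {u p x : R}
    (hε : ∀ f, ε (δ f) = δ (ε f)) (hζ : ∀ f, ζ (δ f) = δ (ζ f)) (hx : δ x = 1)
    (h : ∀ f, schrodinger δ u (flowOp δ ε ζ u p f) = flowOp δ ε ζ u p (schrodinger δ u f)) :
    ε u = δ p ∧ 4 * ζ u = δ (δ (δ p)) - 4 * u * δ p - 2 * δ u * p := by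
  have key : ∀ f, 4 * (ε u - δ p) * δ (δ f) + 4 * (δ (ε u) - δ (δ p)) * δ f
      + (2 * δ (δ (ε u)) - 4 * u * ε u - 2 * p * δ u - δ (δ (δ p)) - 4 * (ζ u)) * f
      = 0 := by
    intro f
    have hf := h f
    simp only [schrodinger_apply, flowOp, map_sub, map_add, Derivation.leibniz, smul_eq_mul, hε, hζ,
      derivation_two, derivation_four, mul_zero, add_zero] at hf
    linear_combination hf
  have h0 := key 1
  have h1 := key x
  have h2 := key (x * x)
  simp only [Derivation.map_one_eq_zero, map_zero, mul_zero, zero_add, mul_one] at h0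
  simp only [hx, Derivation.map_one_eq_zero, h0, mul_zero, zero_add, mul_one, zero_mul, add_zero]
    at h1
  simp only [Derivation.leibniz, hx, smul_eq_mul, map_add, mul_one, h1, h0] at h2
  have e : ε u = δ p := by
    refine sub_eq_zero.1 (eq_zero_of_natCast_mul F (n := 8) (by norm_num) ?_)
    push_cast
    linear_combination h2
  refine ⟨e, ?_⟩
  rw [e] at h0
  linear_combination -h0

/-- Modulo the relations already known, the commutator is a third-order operator in `δ` without
second-order term, so the test functions `1`, `x`, `x³` suffice. -/
theorem relations_of_commute_flowOp {δ ε ε' η η' : Derivation F R R} {u p q x : R}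
    (hε : ∀ f, ε (δ f) = δ (ε f)) (hε' : ∀ f, ε' (δ f) = δ (ε' f))
    (hη : ∀ f, η (δ f) = δ (η f)) (hη' : ∀ f, η' (δ f) = δ (η' f))
    (hηε : ∀ f, η (ε f) = ε (η f)) (hηε' : ∀ f, ε' (η f) = η (ε' f))
    (hη'ε : ∀ f, η' (ε f) = ε (η' f)) (hη'ε' : ∀ f, η' (ε' f) = ε' (η' f)) (hx : δ x = 1)
    (hp : ε u = δ p) (hq : η u = δ q)
    (hp' : 4 * ε' u = δ (δ (δ p)) - 4 * u * δ p - 2 * δ u * p)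
    (hq' : 4 * η' u = δ (δ (δ q)) - 4 * u * δ q - 2 * δ u * q)
    (h : ∀ f, flowOp δ ε ε' u p (flowOp δ η η' u q f) =
      flowOp δ η η' u q (flowOp δ ε ε' u p f)) :
    ε q = η p ∧ 2 * (ε' q - η' p) = q * δ p - p * δ q := by
  have hs : δ (ε q) = δ (η p) := by
    rw [← hε, ← hη, ← hp, ← hq, hηε]
  have key : ∀ f, -8 * (ε q - η p) * δ (δ (δ f))
      + (8 * u * (ε q - η p) - 4 * (q * δ p - p * δ q) + 8 * (ε' q - η' p)) * δ f
      + (6 * (p * δ (δ q) - q * δ (δ p)) + 12 * (δ (ε' q) - δ (η' p))) * f = 0 := by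
    intro f
    have hf := h f
    simp only [flowOp, map_sub, map_add, Derivation.leibniz, smul_eq_mul, hε, hη, hε', hη', hηε,
      hηε', hη'ε, hη'ε', hp, hq, hs,
      derivation_two, derivation_four, mul_zero, add_zero] at hf
    -- The coefficients of `ε f` and `η f` are multiples of the two third-order relations, so these
    -- terms drop out.
    linear_combination hf + 4 * ε f * hq' - 4 * η f * hp'
  have h0 := key 1
  have h1 := key x
  have h3 := key (x * (x * x))
  simp only [Derivation.map_one_eq_zero, map_zero, mul_zero, zero_add, mul_one] at h0
  simp only [hx, Derivation.map_one_eq_zero, h0, map_zero, mul_zero, zero_add, mul_one, zero_mul,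
    add_zero] at h1
  simp only [h0, h1, Derivation.leibniz, hx, smul_eq_mul, map_add, mul_one,
    Derivation.map_one_eq_zero, mul_zero, zero_mul, add_zero] at h3
  have e : ε q = η p := by
    refine sub_eq_zero.1 (eq_zero_of_natCast_mul F (n := 48) (by norm_num) ?_)
    push_cast
    linear_combination -h3
  refine ⟨e, ?_⟩
  rw [e] at h1
  refine sub_eq_zero.1 (eq_zero_of_natCast_mul F (n := 4) (by norm_num) ?_)
  push_cast
  linear_combination h1

/-! ### The first integral -/

/-- The relations give `ξ ∂_{i+1} E = ∂_i E`; starting from `∂_0 = 0`, constancy propagates to every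
flow. -/
theorem deriv_energy_eq_zero {d : ℕ → Derivation F R R} {v : ℕ → R} (hv0 : v 0 = -2)
    (hd0 : d 0 = 0) (hcomm : ∀ i f, d i (d 1 f) = d 1 (d i f))
    (hlen : ∀ j, 4 * d 1 (v (j + 1)) =
      d 1 (d 1 (d 1 (v j))) - 4 * v 1 * d 1 (v j) - 2 * d 1 (v 1) * v j)
    (hdub : ∀ i j, 2 * (d (i + 1) (v j) - d i (v (j + 1))) = v j * d 1 (v i) - v i * d 1 (v j))
    (i : ℕ) : coeffDeriv (d i) (energy (d 1) (v 1) (PowerSeries.mk v)) = 0 := by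
  set w := PowerSeries.mk v with hw
  have hdv0 : ∀ i, d i (v 0) = 0 := fun i => by
    rw [hv0, Derivation.map_neg, derivation_two, neg_zero]
  have hd1 : ∀ i, d i (v 1) = d 1 (v i) := fun i => by
    have := hdub i 0
    rw [hdv0, hdv0, hv0] at this
    refine sub_eq_zero.1 (eq_zero_of_natCast_mul F (n := 2) (by norm_num) ?_)
    push_cast
    linear_combination -this
  -- The Lenard recursions for all `j` at once; the constant term holds because `v_0` is constant.
  have hA : X * coeffDeriv (d 1) (coeffDeriv (d 1) (coeffDeriv (d 1) w))
      - (C 4 * coeffDeriv (d 1) w + X * (C (4 * v 1) * coeffDeriv (d 1) w))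
      - X * (C (2 * d 1 (v 1)) * w) = 0 := by
    ext n
    rcases n with _ | n
    · simp [hw, hdv0, coeff_zero_X_mul, -coeff_zero_eq_constantCoeff]
    · simp only [map_sub, map_add, coeff_succ_X_mul, coeff_C_mul, coeff_coeffDeriv, hw, coeff_mk,
        map_zero]
      linear_combination -hlen n
  have hB : ∀ i, C 2 * (X * coeffDeriv (d (i + 1)) w - coeffDeriv (d i) w) =
      X * (C (d 1 (v i)) * w - C (v i) * coeffDeriv (d 1) w) := by
    intro i
    ext n
    rcases n with _ | n
    · simp [hw, hdv0, coeff_zero_X_mul, -coeff_zero_eq_constantCoeff]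
    · simp only [map_sub, coeff_succ_X_mul, coeff_C_mul, coeff_coeffDeriv, hw, coeff_mk]
      linear_combination hdub i n
  have hof : ∀ i, coeffDeriv (d i) (4 : R⟦X⟧) = 0 ∧ coeffDeriv (d i) (2 : R⟦X⟧) = 0 := fun i =>
    ⟨derivation_four _, derivation_two _⟩
  have hc : ∀ i f, coeffDeriv (d i) (coeffDeriv (d 1) f) = coeffDeriv (d 1) (coeffDeriv (d i) f) :=
    fun i f => coeffDeriv_comm (hcomm i) f
  have hC2 : (C 2 : R⟦X⟧) = 2 := map_ofNat C 2
  have hC4 : (C 4 : R⟦X⟧) = 4 := map_ofNat C 4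
  have dE : ∀ i, coeffDeriv (d i) (energy (d 1) (v 1) w) =
      X * (2 * coeffDeriv (d 1) w * coeffDeriv (d 1) (coeffDeriv (d i) w)
        - 2 * coeffDeriv (d 1) (coeffDeriv (d 1) (coeffDeriv (d i) w)) * w
        - 2 * coeffDeriv (d 1) (coeffDeriv (d 1) w) * coeffDeriv (d i) w)
      + 4 * X * C (d 1 (v i)) * w ^ 2 + 8 * (1 + X * C (v 1)) * w * coeffDeriv (d i) w := by
    intro i
    simp only [energy, pow_two, map_add, map_sub, Derivation.leibniz, smul_eq_mul, coeffDeriv_X,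
      coeffDeriv_C, hof i, Derivation.map_one_eq_zero, hc, hd1]
    ring
  induction i with
  | zero => rw [hd0]; ext n; simp
  | succ i ih =>
    -- `X` is not a zero divisor, so it is enough to compare `X ∂_{i+1} E` with `∂_i E`.
    refine X_mul_cancel ?_
    rw [mul_zero, ← ih, dE, dE]
    have h0 := hB i
    have h1 := congrArg (coeffDeriv (d 1)) h0
    have h2 := congrArg (coeffDeriv (d 1)) h1
    have h3 := congrArg (C (R := R)) (hlen i)
    simp only [map_sub, map_mul, hC2, hC4] at h0 h1 h2 h3 hA
    simp only [map_add, map_sub, Derivation.leibniz, smul_eq_mul, coeffDeriv_X, coeffDeriv_C, hof 1,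
      mul_zero, add_zero] at h1 h2
    linear_combination (X * coeffDeriv (d 1) w) * h1 - X * w * h2
      - X * coeffDeriv (d 1) (coeffDeriv (d 1) w) * h0 + 4 * (1 + X * C (v 1)) * w * h0
      + X * w * C (v i) * hA + X ^ 2 * w ^ 2 * h3

end CommutingDerivations

end
end KdV

namespace KdV
noncomputable section

open PowerSeries Finset

/-! ### Comparison of the given series with the universal one. -/

section Coefficients

variable {F R : Type*} [Field F] [CommRing R] [Algebra F R] {δ : Derivation F R R}
  {φ : DiffPoly F →ₐ[F] R}

theorem coeffDeriv_map_algHom (hφ : ∀ p, φ (D F p) = δ (φ p)) (f : (DiffPoly F)⟦X⟧) :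
    coeffDeriv δ (PowerSeries.map (φ : DiffPoly F →+* R) f) =
      PowerSeries.map (φ : DiffPoly F →+* R) (coeffDeriv (derivD F) f) := by
  ext n
  simp [derivD_apply, hφ]

variable [CharZero F]

theorem energy_map_lenard (hφ : ∀ p, φ (D F p) = δ (φ p)) :
    energy δ (φ (MvPolynomial.X 0)) (PowerSeries.mk fun n => φ (lenard F n)) = 16 := by
  have h : (PowerSeries.mk fun n => φ (lenard F n)) =
      PowerSeries.map (φ : DiffPoly F →+* R) (PowerSeries.mk (lenard F)) := by
    ext n
    simp
  have h1 := congrArg (PowerSeries.map (φ : DiffPoly F →+* R))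
    (energy_energySeq (derivD F) (MvPolynomial.X 0))
  rw [map_ofNat] at h1
  rw [← h1, h]
  simp only [energy, coeffDeriv_map_algHom hφ, map_add, map_mul, map_sub, map_pow, map_X, map_C,
    map_one]
  rw [map_ofNat, map_ofNat]
  rfl

/-- `c` is the square root of `m / 16`. Then `v` and `c` times the evaluated universal series have
the same energy and the same constant term `-2`, and `energy_injective` identifies them. -/
theorem exists_coefficients [Nontrivial R] (hφ : ∀ p, φ (D F p) = δ (φ p)) {v : ℕ → R}
    (hv0 : v 0 = -2) (hv1 : φ (MvPolynomial.X 0) = v 1) {m : F⟦X⟧}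
    (hm : energy δ (v 1) (PowerSeries.mk v) = PowerSeries.map (algebraMap F R) m) :
    ∃ c : ℕ → F, c 0 = 1 ∧ c 1 = 0 ∧ m = C 16 * PowerSeries.mk c ^ 2 ∧
      PowerSeries.mk v = PowerSeries.map (algebraMap F R) (PowerSeries.mk c) *
        PowerSeries.mk (fun n => φ (lenard F n)) := by
  have hinj := (algebraMap F R).injective
  have hE : energy δ (v 1) (PowerSeries.mk v) =
      X * (coeffDeriv δ (PowerSeries.mk v) ^ 2
        - C 2 * (coeffDeriv δ (coeffDeriv δ (PowerSeries.mk v)) * PowerSeries.mk v)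
        + C (4 * v 1) * PowerSeries.mk v ^ 2) + C 4 * PowerSeries.mk v ^ 2 := by
    rw [map_mul C, map_ofNat C 2, map_ofNat C 4, energy]
    ring
  have hm0 : coeff 0 m = 16 := by
    apply hinj
    have := congrArg (coeff 0) hm
    rw [PowerSeries.coeff_map, hE, map_add, coeff_zero_X_mul, coeff_C_mul, pow_two, coeff_mul,
      Nat.antidiagonal_zero, sum_singleton] at this
    simp only [coeff_mk, hv0] at this
    rw [← this, map_ofNat]
    ring
  -- The coefficient is `4 v_1 v_0² + 8 v_0 v_1 = 16 v_1 - 16 v_1`; this is what forces `c 1 = 0`.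
  have hm1 : coeff 1 m = 0 := by
    apply hinj
    have := congrArg (coeff (0 + 1)) hm
    rw [PowerSeries.coeff_map, hE, map_add, coeff_succ_X_mul, coeff_C_mul, pow_two, pow_two,
      map_add, map_sub, coeff_C_mul, coeff_C_mul, coeff_mul, coeff_mul, coeff_mul, coeff_mul,
      Nat.antidiagonal_zero, sum_singleton, sum_singleton, sum_singleton, zero_add,
      Nat.sum_antidiagonal_succ, Nat.antidiagonal_zero, sum_singleton] at this
    simp [derivation_two, hv0, -coeff_zero_eq_constantCoeff] at this
    rw [← this, map_zero]
    ring
  set c := sqrtSeq (C (1 / 16) * m) with hc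
  have hsq : PowerSeries.mk c ^ 2 = C (1 / 16) * m := sqrtSeq_sq (by
    rw [← coeff_zero_eq_constantCoeff_apply, coeff_C_mul, hm0]
    norm_num)
  have hc0 : c 0 = 1 := by rw [hc, sqrtSeq]
  have hmc : m = C 16 * PowerSeries.mk c ^ 2 := by
    rw [hsq, ← mul_assoc, ← map_mul]
    norm_num
  refine ⟨c, hc0, ?_, hmc, energy_injective (F := F) (δ := δ) (u := v 1) ?_ ?_ ?_⟩
  · rw [hc, sqrtSeq]
    simp [coeff_C_mul, hm1]
  · simpa using hv0
  · rw [map_mul]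
    simp [hc0, lenard, energySeq_zero, ← coeff_zero_eq_constantCoeff_apply]
    exact map_ofNat φ 2
  · rw [energy_mul_map, ← hv1, energy_map_lenard hφ, hv1, hm, hmc, map_mul, PowerSeries.map_C,
      mul_comm, map_ofNat, map_ofNat C 16]

end Coefficients

/-! ### The operator identity, by telescoping. -/

section Operators

variable {F R : Type*} [Field F] [CommRing R] [Algebra F R] (δ : Derivation F R R)

/-- `-p ∂ / 2 + p' / 4`. -/
def firstOrderOp (p : R) : Module.End F R :=
  (-1 / 2 : F) • (LinearMap.mulLeft F p * (δ : R →ₗ[F] R))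
    + (1 / 4 : F) • LinearMap.mulLeft F (δ p)

theorem firstOrderOp_sum {ι : Type*} (s : Finset ι) (c : ι → F) (p : ι → R) :
    firstOrderOp δ (∑ i ∈ s, algebraMap F R (c i) * p i) =
      ∑ i ∈ s, c i • firstOrderOp δ (p i) := by
  refine LinearMap.ext fun x => ?_
  simp only [firstOrderOp, ← Algebra.smul_def, map_sum, Derivation.map_smul, LinearMap.add_apply,
    LinearMap.smul_apply, Module.End.mul_apply, LinearMap.mulLeft_apply, LinearMap.sum_apply,
    smul_add, sum_add_distrib, Finset.sum_mul, Finset.smul_sum, smul_mul_assoc, Derivation.coeFn_coe]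
  congr 1 <;> exact sum_congr rfl fun i _ => smul_comm _ _ _

theorem firstOrderOp_neg_two [CharZero F] : firstOrderOp δ (-2) = (δ : R →ₗ[F] R) := by
  refine LinearMap.ext fun x => ?_
  simp only [firstOrderOp, LinearMap.add_apply, LinearMap.smul_apply, Module.End.mul_apply,
    LinearMap.mulLeft_apply, Derivation.map_neg, derivation_two, Derivation.coeFn_coe]
  rw [neg_zero, zero_mul, smul_zero, add_zero,
    show (-2 : R) = algebraMap F R (-2) by rw [map_neg, map_ofNat], ← Algebra.smul_def, smul_smul]
  norm_num

variable {δ} {φ : DiffPoly F →ₐ[F] R}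

theorem realize_lenardOp_succ (hφ : ∀ p, φ (D F p) = δ (φ p)) (k : ℕ) :
    realize δ φ (lenardOp F (k + 1)) =
      realize δ φ (lenardOp F k) * schrodinger δ (φ (MvPolynomial.X 0))
        + firstOrderOp δ (φ (lenard F (k + 1))) := by
  rw [lenardOp, realize_add, realize_mulSchrodinger hφ, realize_add, realize_single,
    realize_single, schrodinger]
  congr 1
  refine LinearMap.ext fun x => ?_
  simp [firstOrderOp, hφ, ← MvPolynomial.algebraMap_eq, Algebra.smul_def]

variable [CharZero F]

theorem realize_lenardOp_zero : realize δ φ (lenardOp F 0) = firstOrderOp δ (φ (lenard F 0)) := by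
  rw [lenard, energySeq_zero, map_neg, map_ofNat, firstOrderOp_neg_two, lenardOp, realize_single]
  refine LinearMap.ext fun x => ?_
  simp

/-- If `v_j = ∑ c_{j-i} w_i`, then the combination of the Lax operators with coefficients `c` is
the operator built from the sequence `v`. -/
theorem sum_realize_lenardOp (hφ : ∀ p, φ (D F p) = δ (φ p)) {v : ℕ → R} {c : ℕ → F}
    (h : PowerSeries.mk v = PowerSeries.map (algebraMap F R) (PowerSeries.mk c) *
        PowerSeries.mk (fun n => φ (lenard F n))) (n : ℕ) :
    ∑ p ∈ antidiagonal n, c p.1 • realize δ φ (lenardOp F p.2) =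
      ∑ p ∈ antidiagonal n, firstOrderOp δ (v p.1) * schrodinger δ (φ (MvPolynomial.X 0)) ^ p.2 := by
  have hv : ∀ j, firstOrderOp δ (v j) =
      ∑ p ∈ antidiagonal j, c p.1 • firstOrderOp δ (φ (lenard F p.2)) := by
    intro j
    have := congrArg (coeff j) h
    rw [coeff_mul] at this
    simp only [coeff_mk, PowerSeries.coeff_map] at this
    rw [this, firstOrderOp_sum]
  induction n with
  | zero =>
    simp [hv, realize_lenardOp_zero]
  | succ n ih =>
    -- Both sides obey `S_{n+1} = S_n L + B(v_{n+1})`, on the left because `A_{k+1} = A_k L +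
    -- B(w_{k+1})`.
    rw [Nat.sum_antidiagonal_succ', Nat.sum_antidiagonal_succ', hv (n + 1),
      Nat.sum_antidiagonal_succ' (n := n)]
    simp only [realize_lenardOp_succ hφ, smul_add, sum_add_distrib, pow_succ, ← mul_assoc,
      ← Finset.sum_mul, pow_zero, mul_one, ← ih, realize_lenardOp_zero]
    simp only [Finset.sum_mul, smul_mul_assoc]
    abel

/-- The operators `∂²∂_k - (u ∂_k + ∂_k u) / 2 - (v_k ∂ + ∂ v_k) / 4 - ∂_{k+1}`. -/
def evolutionOp (d : ℕ → Derivation F R R) (v : ℕ → R) (k : ℕ) : Module.End F R :=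
  (d 1 : R →ₗ[F] R) ^ 2 * (d k : R →ₗ[F] R)
    - (1 / 2 : F) • (LinearMap.mulLeft F (v 1) * (d k : R →ₗ[F] R)
      + (d k : R →ₗ[F] R) * LinearMap.mulLeft F (v 1))
    - (1 / 4 : F) • (LinearMap.mulLeft F (v k) * (d 1 : R →ₗ[F] R)
      + (d 1 : R →ₗ[F] R) * LinearMap.mulLeft F (v k))
    - (d (k + 1) : R →ₗ[F] R)

theorem four_smul_evolutionOp (d : ℕ → Derivation F R R) (v : ℕ → R) (k : ℕ) (f : R) :
    (4 : F) • evolutionOp d v k f = flowOp (d 1) (d k) (d (k + 1)) (v 1) (v k) f := by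
  have e4 : ∀ r : R, (4 : F) • r = 4 * r := fun r => by rw [Algebra.smul_def, map_ofNat]
  have e2 : ∀ r : R, (2 : F) • r = 2 * r := fun r => by rw [Algebra.smul_def, map_ofNat]
  simp only [evolutionOp, flowOp, LinearMap.sub_apply, LinearMap.add_apply, LinearMap.smul_apply,
    Module.End.mul_apply, pow_two, LinearMap.mulLeft_apply, smul_sub, smul_smul,
    Derivation.coeFn_coe]
  norm_num
  simp only [e4, e2]
  ring

/-- This form makes the sum of the `U_k L^(g-k)` telescope: `-∂_{k+1}` in one term meets `∂_{k+1} L`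
in the next. -/
theorem evolutionOp_eq {d : ℕ → Derivation F R R} {v : ℕ → R} {k : ℕ}
    (hcomm : ∀ f, d k (d 1 f) = d 1 (d k f)) (hk : d k (v 1) = d 1 (v k)) :
    evolutionOp d v k = (d k : R →ₗ[F] R) * schrodinger (d 1) (v 1) - (d (k + 1) : R →ₗ[F] R)
      + firstOrderOp (d 1) (v k) := by
  refine LinearMap.ext fun f => ?_
  have e4 : ∀ r : R, (4 : F) • r = 4 * r := fun r => by rw [Algebra.smul_def, map_ofNat]
  have e2 : ∀ r : R, (2 : F) • r = 2 * r := fun r => by rw [Algebra.smul_def, map_ofNat]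
  have h4 : Function.Injective fun r : R => (4 : F) • r := fun a b hab => by
    have := congrArg (fun r : R => (1 / 4 : F) • r) hab
    simpa [smul_smul] using this
  apply h4
  simp only
  rw [four_smul_evolutionOp]
  simp only [flowOp, LinearMap.sub_apply, LinearMap.add_apply, LinearMap.smul_apply, firstOrderOp,
    Module.End.mul_apply, LinearMap.mulLeft_apply, smul_sub, smul_add, smul_smul,
    schrodinger_apply, Derivation.coeFn_coe, map_sub, Derivation.leibniz, hcomm, hk, smul_eq_mul]
  norm_num
  simp only [e4, e2]
  ring

theorem sum_evolutionOp {d : ℕ → Derivation F R R} {v : ℕ → R} {g : ℕ} (hv0 : v 0 = -2)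
    (hcomm : ∀ i f, d i (d 1 f) = d 1 (d i f)) (hd1 : ∀ i, d i (v 1) = d 1 (v i))
    (hg : d (g + 1) = 0) :
    ∑ k ∈ Icc 1 g, evolutionOp d v k * schrodinger (d 1) (v 1) ^ (g - k) =
      ∑ p ∈ antidiagonal g, firstOrderOp (d 1) (v p.1) * schrodinger (d 1) (v 1) ^ p.2 := by
  -- A partial sum leaves the remainder `∂_{n+1}`, which vanishes at `n = g`. At `n = 0` the empty
  -- sum is matched by `B(-2) = ∂`.
  have key : ∀ n, ∑ k ∈ Icc 1 n, evolutionOp d v k * schrodinger (d 1) (v 1) ^ (n - k) =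
      ∑ p ∈ antidiagonal n, firstOrderOp (d 1) (v p.1) * schrodinger (d 1) (v 1) ^ p.2
        - (d (n + 1) : R →ₗ[F] R) := by
    intro n
    induction n with
    | zero => simp [hv0, firstOrderOp_neg_two]
    | succ n ih =>
      have h1 : ∑ k ∈ Icc 1 n, evolutionOp d v k * schrodinger (d 1) (v 1) ^ (n + 1 - k) =
          (∑ k ∈ Icc 1 n, evolutionOp d v k * schrodinger (d 1) (v 1) ^ (n - k)) *
            schrodinger (d 1) (v 1) := by
        rw [Finset.sum_mul]
        refine sum_congr rfl fun k hk => ?_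
        rw [mul_assoc, ← pow_succ, Nat.sub_add_comm (mem_Icc.1 hk).2]
      rw [sum_Icc_succ_top (by omega), h1, ih, Nat.sum_antidiagonal_succ', Nat.sub_self, pow_zero,
        mul_one, evolutionOp_eq (hcomm _) (hd1 _)]
      simp only [pow_succ, ← mul_assoc, ← Finset.sum_mul, mul_one]
      rw [sub_mul]
      abel
  rw [key, hg]
  simp

end Operators

end
end KdV

namespace KdV
noncomputable section

open PowerSeries Finset

/-! ### Relations for the whole sequence `v`, boundary indices included. -/

section AbstractFamily

variable {F R : Type*} [Field F] [CommRing R] [Algebra F R]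
  {d : ℕ → Derivation F R R} {v : ℕ → R} {g : ℕ}

theorem derivation_apply_zero (hv0 : v 0 = -2) (i : ℕ) : d i (v 0) = 0 := by
  rw [hv0, Derivation.map_neg, derivation_two, neg_zero]

variable [CharZero F]

theorem commute_flowOp {k : ℕ} {T : Module.End F R} (h : T * evolutionOp d v k = evolutionOp d v k * T)
    (f : R) : T (flowOp (d 1) (d k) (d (k + 1)) (v 1) (v k) f) =
      flowOp (d 1) (d k) (d (k + 1)) (v 1) (v k) (T f) := by
  have := LinearMap.congr_fun h f
  simp only [Module.End.mul_apply] at this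
  rw [← four_smul_evolutionOp, ← four_smul_evolutionOp, map_smul, this]

theorem derivation_potential (hv0 : v 0 = -2) (hvg : ∀ j, g < j → v j = 0) (hd0 : d 0 = 0)
    (hdg : ∀ i, g < i → d i = 0) (hcomm : ∀ i j f, d i (d j f) = d j (d i f)) {x : R}
    (hx : d 1 x = 1)
    (hL : ∀ k ∈ Icc 1 g, schrodinger (d 1) (v 1) * evolutionOp d v k =
      evolutionOp d v k * schrodinger (d 1) (v 1)) (i : ℕ) : d i (v 1) = d 1 (v i) := by
  rcases Nat.eq_zero_or_pos i with rfl | h0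
  · rw [derivation_apply_zero hv0, hd0, Derivation.zero_apply]
  rcases lt_or_ge g i with h1 | h1
  · rw [hvg i h1, hdg i h1, Derivation.zero_apply, map_zero]
  · exact (relations_of_commute_schrodinger (hcomm _ _) (hcomm _ _) hx
      (commute_flowOp (hL i (mem_Icc.2 ⟨h0, h1⟩)))).1

/-- The value `v 0 = -2` makes the recursion start correctly at `j = 0`, and `v (g + 1) = 0` closes
it at `j = g`; hence it holds for all `j`, as generating functions need. -/
theorem lenard_relation (hv0 : v 0 = -2) (hvg : ∀ j, g < j → v j = 0) (hd0 : d 0 = 0)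
    (hdg : ∀ i, g < i → d i = 0) (hcomm : ∀ i j f, d i (d j f) = d j (d i f)) {x : R}
    (hx : d 1 x = 1)
    (hL : ∀ k ∈ Icc 1 g, schrodinger (d 1) (v 1) * evolutionOp d v k =
      evolutionOp d v k * schrodinger (d 1) (v 1)) (j : ℕ) : 4 * d 1 (v (j + 1)) =
      d 1 (d 1 (d 1 (v j))) - 4 * v 1 * d 1 (v j) - 2 * d 1 (v 1) * v j := by
  rcases Nat.eq_zero_or_pos j with rfl | h0
  · rw [derivation_apply_zero hv0, hv0, map_zero, map_zero]
    ring
  rcases lt_or_ge g j with h1 | h1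
  · rw [hvg j h1, hvg (j + 1) (by omega)]
    simp
  · rw [← derivation_potential hv0 hvg hd0 hdg hcomm hx hL (j + 1)]
    exact (relations_of_commute_schrodinger (hcomm _ _) (hcomm _ _) hx
      (commute_flowOp (hL j (mem_Icc.2 ⟨h0, h1⟩)))).2

/-- Commutation produces `∂_{i+1} v_j - ∂_{j+1} v_i`; the symmetry `∂_i v_{j+1} = ∂_{j+1} v_i` puts
it into a form with one fixed flow index, suited to a series in `j`. -/
theorem dubrovin_relation (hv0 : v 0 = -2) (hvg : ∀ j, g < j → v j = 0) (hd0 : d 0 = 0)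
    (hdg : ∀ i, g < i → d i = 0) (hcomm : ∀ i j f, d i (d j f) = d j (d i f)) {x : R}
    (hx : d 1 x = 1)
    (hL : ∀ k ∈ Icc 1 g, schrodinger (d 1) (v 1) * evolutionOp d v k =
      evolutionOp d v k * schrodinger (d 1) (v 1))
    (hU : ∀ i ∈ Icc 1 g, ∀ k ∈ Icc 1 g, evolutionOp d v i * evolutionOp d v k =
      evolutionOp d v k * evolutionOp d v i) (i j : ℕ) :
    2 * (d (i + 1) (v j) - d i (v (j + 1))) = v j * d 1 (v i) - v i * d 1 (v j) := by
  have hd1 := derivation_potential hv0 hvg hd0 hdg hcomm hx hL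
  have hrel : ∀ i ∈ Icc 1 g, ∀ j ∈ Icc 1 g, d i (v j) = d j (v i) ∧
      2 * (d (i + 1) (v j) - d (j + 1) (v i)) = v j * d 1 (v i) - v i * d 1 (v j) := by
    intro i hi j hj
    have hi2 := (relations_of_commute_schrodinger (hcomm _ _) (hcomm _ _) hx
      (commute_flowOp (hL i hi))).2
    have hj2 := (relations_of_commute_schrodinger (hcomm _ _) (hcomm _ _) hx
      (commute_flowOp (hL j hj))).2
    refine relations_of_commute_flowOp (hcomm _ _) (hcomm _ _) (hcomm _ _) (hcomm _ _)
      (hcomm _ _) (hcomm _ _) (hcomm _ _) (hcomm _ _) hx (hd1 i) (hd1 j) hi2 hj2 fun f => ?_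
    have := commute_flowOp (hU i hi j hj) f
    rw [← four_smul_evolutionOp d v i, ← four_smul_evolutionOp d v i, this]
    rw [← four_smul_evolutionOp d v j, ← four_smul_evolutionOp d v j, map_smul, smul_comm]
  rcases Nat.eq_zero_or_pos i with rfl | hi0
  · rw [hd0, derivation_apply_zero hv0, hv0, Derivation.zero_apply]
    ring
  rcases Nat.eq_zero_or_pos j with rfl | hj0
  · rw [derivation_apply_zero hv0, derivation_apply_zero hv0, hv0, zero_add, hd1]
    ring
  rcases lt_or_ge g i with hi | hi
  · rw [hdg i hi, hdg (i + 1) (by omega), hvg i hi]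
    simp
  rcases lt_or_ge g j with hj | hj
  · rw [hvg j hj, hvg (j + 1) (by omega)]
    simp
  have hi' := mem_Icc.2 ⟨hi0, hi⟩
  rw [← (hrel i hi' j (mem_Icc.2 ⟨hj0, hj⟩)).2]
  rcases lt_or_ge g (j + 1) with hj1 | hj1
  · rw [hvg _ hj1, hdg _ hj1, map_zero, Derivation.zero_apply]
  · rw [(hrel i hi' (j + 1) (mem_Icc.2 ⟨by omega, hj1⟩)).1]

theorem exists_map_eq_energy (hv0 : v 0 = -2) (hvg : ∀ j, g < j → v j = 0) (hd0 : d 0 = 0)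
    (hdg : ∀ i, g < i → d i = 0) (hcomm : ∀ i j f, d i (d j f) = d j (d i f)) {x : R}
    (hx : d 1 x = 1)
    (hconst : ∀ r, (∀ i ∈ Icc 1 g, d i r = 0) → ∃ a : F, algebraMap F R a = r)
    (hL : ∀ k ∈ Icc 1 g, schrodinger (d 1) (v 1) * evolutionOp d v k =
      evolutionOp d v k * schrodinger (d 1) (v 1))
    (hU : ∀ i ∈ Icc 1 g, ∀ k ∈ Icc 1 g, evolutionOp d v i * evolutionOp d v k =
      evolutionOp d v k * evolutionOp d v i) :
    ∃ m : F⟦X⟧, energy (d 1) (v 1) (PowerSeries.mk v) = PowerSeries.map (algebraMap F R) m := by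
  have h : ∀ n, ∃ a : F,
      algebraMap F R a = coeff n (energy (d 1) (v 1) (PowerSeries.mk v)) := by
    refine fun n => hconst _ fun i _ => ?_
    rw [← coeff_coeffDeriv, deriv_energy_eq_zero hv0 hd0 (fun i f => hcomm i 1 f)
      (lenard_relation hv0 hvg hd0 hdg hcomm hx hL)
      (dubrovin_relation hv0 hvg hd0 hdg hcomm hx hL hU), map_zero]
  choose m hm using h
  exact ⟨PowerSeries.mk m, by ext n; simp [hm]⟩

end AbstractFamily

/-! ### Stationary equation, uniqueness of its constants, and the values `μ_k`. -/

section Consequences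

variable {F R : Type*} [Field F] [CommRing R] [Algebra F R]

/-- `c 0 = 1` gives the leading term, and `c 1 = 0` is why no term with index `g - 1` occurs. -/
theorem sum_range_of_normalized {M : Type*} [AddCommGroup M] [Module F M] {c : ℕ → F}
    (hc0 : c 0 = 1) (hc1 : c 1 = 0) {g : ℕ} (hg : 1 ≤ g) (x : ℕ → M) :
    ∑ p ∈ antidiagonal g, c p.1 • x p.2 = x g + ∑ k ∈ range (g - 1), c (g - k) • x k := by
  obtain ⟨n, rfl⟩ : ∃ n, g = n + 1 := ⟨g - 1, by omega⟩
  rw [← Nat.sum_antidiagonal_swap]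
  simp only [Prod.fst_swap, Prod.snd_swap]
  rw [Nat.sum_antidiagonal_eq_sum_range_succ (fun i j => c j • x i), sum_range_succ, sum_range_succ]
  simp [hc0, hc1, add_comm]

variable {δ : Derivation F R R} {φ : DiffPoly F →ₐ[F] R} {v : ℕ → R} {c : ℕ → F}

/-- The stationary equation. -/
theorem sum_deriv_lenard_eq_zero [CharZero F]
    (h : PowerSeries.mk v = PowerSeries.map (algebraMap F R) (PowerSeries.mk c) *
        PowerSeries.mk (fun n => φ (lenard F n))) {g : ℕ} (hg : v (g + 1) = 0) :
    ∑ p ∈ antidiagonal g, c p.1 • δ (φ (lenard F (p.2 + 1))) = 0 := by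
  have h1 := congrArg (fun f : R⟦X⟧ => δ (coeff (g + 1) f)) h
  simp only [coeff_mk, coeff_mul, PowerSeries.coeff_map, hg, map_zero, map_add, map_sum,
    ← Algebra.smul_def, Derivation.map_smul, Nat.sum_antidiagonal_succ'] at h1
  rw [h1, lenard, energySeq_zero, map_neg, map_ofNat, Derivation.map_neg, derivation_two, neg_zero,
    smul_zero, zero_add]

/-- If the `v_j'`, `1 ≤ j ≤ g`, are linearly independent, then so are the `w_j'`,
`1 ≤ j < g`. -/
theorem eq_zero_of_sum_deriv_lenard_eq_zero [CharZero F] (hc0 : c 0 = 1) (hv0 : v 0 = -2)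
    (h : PowerSeries.mk v = PowerSeries.map (algebraMap F R) (PowerSeries.mk c) *
        PowerSeries.mk (fun n => φ (lenard F n))) {g : ℕ}
    (hind : ∀ γ : ℕ → F, ∑ j ∈ Icc 1 g, γ j • δ (v j) = 0 → ∀ j ∈ Icc 1 g, γ j = 0) {β : ℕ → F}
    (hβ : ∑ k ∈ range (g - 1), β k • δ (φ (lenard F (k + 1))) = 0) :
    ∀ k < g - 1, β k = 0 := by
  have hcc : constantCoeff (PowerSeries.mk c) ≠ 0 := by
    simp [← coeff_zero_eq_constantCoeff_apply, hc0]
  set e := fun n => coeff n (PowerSeries.mk c)⁻¹ with he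
  have he0 : e 0 = 1 := by
    simp only [he, coeff_zero_eq_constantCoeff_apply, constantCoeff_inv]
    simp [← coeff_zero_eq_constantCoeff_apply, hc0]
  -- Inverting `c` expresses `w_{n+1}'` through `v_1', …, v_{n+1}'` with leading coefficient `1`.
  have hinv : PowerSeries.mk (fun n => φ (lenard F n)) =
      PowerSeries.map (algebraMap F R) (PowerSeries.mk e) * PowerSeries.mk v := by
    have : PowerSeries.mk e = (PowerSeries.mk c)⁻¹ := by ext n; simp [he]
    rw [h, ← mul_assoc, ← map_mul, this, PowerSeries.inv_mul_cancel _ hcc, map_one, one_mul]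
  have hw : ∀ n, δ (φ (lenard F (n + 1))) =
      ∑ j ∈ range (n + 1), e (n - j) • δ (v (j + 1)) := by
    intro n
    have h1 := congrArg (fun f : R⟦X⟧ => δ (coeff (n + 1) f)) hinv
    simp only [coeff_mk, coeff_mul, PowerSeries.coeff_map, map_add, map_sum,
      ← Algebra.smul_def, Derivation.map_smul, Nat.sum_antidiagonal_succ'] at h1
    rw [h1, hv0, Derivation.map_neg, derivation_two, neg_zero, smul_zero, zero_add,
      ← Nat.sum_antidiagonal_swap]
    simp only [Prod.fst_swap, Prod.snd_swap]
    rw [Nat.sum_antidiagonal_eq_sum_range_succ (fun i j => e j • δ (v (i + 1)))]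
  have hγ := hind (fun j => ∑ k ∈ range (g - 1), if j ≤ k + 1 then β k * e (k + 1 - j) else 0) (by
    rw [← hβ]
    simp only [Finset.sum_smul, ite_smul, zero_smul]
    rw [sum_comm]
    refine sum_congr rfl fun k hk => ?_
    rw [hw, Finset.smul_sum, ← sum_filter]
    have : (Icc 1 g).filter (fun j => j ≤ k + 1) = (range (k + 1)).map ⟨Nat.succ, Nat.succ_injective⟩ := by
      ext j
      simp only [mem_filter, mem_Icc, Finset.mem_map, Finset.mem_range, Function.Embedding.coeFn_mk]
      have := Finset.mem_range.1 hk
      constructor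
      · intro hj
        exact ⟨j - 1, by omega, by omega⟩
      · rintro ⟨i, hi, rfl⟩
        omega
    rw [this, sum_map]
    refine sum_congr rfl fun j _ => ?_
    simp only [Function.Embedding.coeFn_mk, Nat.succ_eq_add_one, Nat.add_sub_add_right, mul_smul])
  -- Downward induction on `k`: the coefficient of `v_{k+1}'` is `β k` plus terms in `β l` with `l >
  -- k`.
  have key : ∀ n k, k < g - 1 → g - 1 - k ≤ n → β k = 0 := by
    intro n
    induction n with
    | zero => intro k hk hn; omega
    | succ n ih =>
      intro k hk hn
      have h1 := hγ (k + 1) (mem_Icc.2 ⟨by omega, by omega⟩)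
      rw [sum_eq_single k] at h1
      · simpa [he0] using h1
      · intro l hl hlk
        split_ifs with hle
        · rw [ih l (Finset.mem_range.1 hl) (by omega), zero_mul]
        · rfl
      · intro hk'
        exact absurd (Finset.mem_range.2 hk) hk'
  exact fun k hk => key _ k hk le_rfl

/-- The terms containing `c 0` give `2 c_{k+1}` and those containing `c 1` vanish. Indices have the
form `g - j` because `a_j = c_{g-j}`; the range of `k` keeps the truncated subtractions exact. -/
theorem coeff_succ_sq_of_normalized (hc0 : c 0 = 1) (hc1 : c 1 = 0) {g k : ℕ}
    (hk : k ∈ Icc 1 (g - 1)) :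
    coeff (k + 1) (PowerSeries.mk c ^ 2) = 2 * c (g - (g - k - 1)) +
      ∑ i ∈ Icc 1 (k - 2), c (g - (g - i - 1)) * c (g - (g - k + i)) := by
  obtain ⟨h1, h2⟩ := mem_Icc.1 hk
  rw [pow_two, coeff_mul]
  simp only [coeff_mk]
  rw [Nat.sum_antidiagonal_eq_sum_range_succ (fun i j => c i * c j), Nat.succ_eq_add_one,
    sum_range_mul_self, hc0, one_mul, show g - (g - k - 1) = k + 1 by omega]
  congr 1
  obtain ⟨k, rfl⟩ : ∃ l, k = l + 1 := ⟨k - 1, by omega⟩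
  rw [sum_range_succ', zero_add, hc1, zero_mul, add_zero]
  rcases k with _ | k
  · simp
  rw [sum_range_succ, show k + 1 + 1 - (k + 1) = 1 by omega, hc1, mul_zero, add_zero,
    show k + 1 + 1 - 2 = k by omega, ← Finset.Ico_add_one_right_eq_Icc, sum_Ico_eq_sum_range,
    Nat.add_sub_cancel]
  refine sum_congr rfl fun i hi => ?_
  have := Finset.mem_range.1 hi
  rw [show g - (g - (1 + i) - 1) = i + 1 + 1 by omega,
    show g - (g - (k + 1 + 1) + (1 + i)) = k + 1 + 1 - (i + 1) by omega]

theorem mk_eq_coe_polynomial {S : Type*} [CommRing S] {a : ℕ → S} {g : ℕ}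
    (ha : ∀ j, g < j → a j = 0) :
    PowerSeries.mk a = ((∑ i ∈ range (g + 1), Polynomial.C (a i) * Polynomial.X ^ i :
      Polynomial S) : S⟦X⟧) := by
  ext n
  simp only [coeff_mk, Polynomial.coeff_coe, Polynomial.finsetSum_coeff, Polynomial.coeff_C_mul,
    Polynomial.coeff_X_pow, mul_ite, mul_one, mul_zero, sum_ite_eq, Finset.mem_range]
  split_ifs with h
  · rfl
  · exact ha n (by omega)

/-- Formal identity to values at `ξ`: the series are polynomials of degree at most `g`, so the
energy is a polynomial of degree at most `2g + 1`. -/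
theorem sum_coeff_energy_eq {S : Type*} [CommRing S] {a a₁ a₂ : ℕ → S} {b : S} {m : S⟦X⟧} {g : ℕ}
    (ha : ∀ j, g < j → a j = 0) (ha₁ : ∀ j, g < j → a₁ j = 0) (ha₂ : ∀ j, g < j → a₂ j = 0)
    (h : X * (PowerSeries.mk a₁ ^ 2 - 2 * PowerSeries.mk a₂ * PowerSeries.mk a)
      + 4 * (1 + X * C b) * PowerSeries.mk a ^ 2 = m) (ξ : S) :
    ∑ i ∈ range (2 * g + 2), coeff i m * ξ ^ i =
      ξ * ((∑ i ∈ range (g + 1), a₁ i * ξ ^ i) ^ 2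
        - 2 * (∑ i ∈ range (g + 1), a₂ i * ξ ^ i) * ∑ i ∈ range (g + 1), a i * ξ ^ i)
      + 4 * (1 + ξ * b) * (∑ i ∈ range (g + 1), a i * ξ ^ i) ^ 2 := by
  set p : (ℕ → S) → Polynomial S :=
    fun a => ∑ i ∈ range (g + 1), Polynomial.C (a i) * Polynomial.X ^ i with hp
  have hdeg : ∀ a, (p a).natDegree ≤ g := fun a =>
    Polynomial.natDegree_sum_le_of_forall_le _ _ fun i hi =>
      (Polynomial.natDegree_C_mul_X_pow_le _ _).trans (by have := Finset.mem_range.1 hi; omega)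
  set M : Polynomial S := Polynomial.X * (p a₁ ^ 2 - Polynomial.C 2 * (p a₂ * p a))
    + Polynomial.C 4 * ((1 + Polynomial.X * Polynomial.C b) * p a ^ 2) with hM
  have hmM : m = (M : S⟦X⟧) := by
    rw [← h, mk_eq_coe_polynomial ha, mk_eq_coe_polynomial ha₁, mk_eq_coe_polynomial ha₂, hM]
    simp only [Polynomial.coe_add, Polynomial.coe_mul, Polynomial.coe_sub, Polynomial.coe_X,
      Polynomial.coe_pow, Polynomial.coe_C, Polynomial.coe_one, hp]
    rw [map_ofNat C 2, map_ofNat C 4]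
    ring
  have hMdeg : M.natDegree < 2 * g + 2 := by
    have h1 := hdeg a
    have h2 := hdeg a₁
    have h3 := hdeg a₂
    have : M.natDegree ≤ 1 + 2 * g := by
      refine Polynomial.natDegree_add_le_of_degree_le ?_ ?_
      · refine Polynomial.natDegree_mul_le_of_le Polynomial.natDegree_X_le ?_
        refine (Polynomial.natDegree_sub_le _ _).trans (max_le ?_ ?_)
        · exact Polynomial.natDegree_pow_le_of_le 2 h2
        · refine (Polynomial.natDegree_C_mul_le _ _).trans ?_
          exact (Polynomial.natDegree_mul_le_of_le h3 h1).trans (by omega)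
      · refine (Polynomial.natDegree_C_mul_le _ _).trans ?_
        refine Polynomial.natDegree_mul_le_of_le ?_ (Polynomial.natDegree_pow_le_of_le 2 h1)
        refine Polynomial.natDegree_add_le_of_degree_le (by simp) ?_
        exact (Polynomial.natDegree_mul_C_le _ _).trans Polynomial.natDegree_X_le
    omega
  have heval := Polynomial.eval_eq_sum_range' hMdeg ξ
  rw [hmM]
  simp only [Polynomial.coeff_coe]
  rw [← heval, hM]
  simp [hp, Polynomial.eval_finsetSum]
  ring

end Consequences

end
end KdV

namespace KdV
noncomputable section

open Finset

/-! ### Smooth functions on `U` as a differential algebra. -/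

section SmoothFunctions

variable {𝕜 F : Type*} [RCLike 𝕜] [RCLike F] [NormedAlgebra 𝕜 F] {g : ℕ}

/-! ### Partial derivatives -/

theorem pd_add {i : ℕ} {f h : (Fin g → 𝕜) → F} {t : Fin g → 𝕜} (hf : DifferentiableAt 𝕜 f t)
    (hh : DifferentiableAt 𝕜 h t) : pd i (f + h) t = pd i f t + pd i h t := by
  simp [pd, fderiv_add hf hh]

theorem pd_mul {i : ℕ} {f h : (Fin g → 𝕜) → F} {t : Fin g → 𝕜} (hf : DifferentiableAt 𝕜 f t)
    (hh : DifferentiableAt 𝕜 h t) : pd i (f * h) t = f t * pd i h t + h t * pd i f t := by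
  simp [pd, fderiv_mul hf hh]

theorem pd_const_smul {i : ℕ} {f : (Fin g → 𝕜) → F} {t : Fin g → 𝕜}
    (hf : DifferentiableAt 𝕜 f t) (c : F) : pd i (c • f) t = c * pd i f t := by
  have : c • f = (fun _ => c) * f := rfl
  rw [this, pd_mul (differentiableAt_const c) hf]
  simp [pd]

theorem pd_congr {U : Set (Fin g → 𝕜)} (hU : IsOpen U) {i : ℕ} {f h : (Fin g → 𝕜) → F}
    (hfh : Set.EqOn f h U) : Set.EqOn (pd i f) (pd i h) U := by
  intro t ht
  have : f =ᶠ[nhds t] h := Filter.eventuallyEq_of_mem (hU.mem_nhds ht) hfh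
  simp [pd, this.fderiv_eq]

theorem contDiffOn_pd {U : Set (Fin g → 𝕜)} (hU : IsOpen U) {f : (Fin g → 𝕜) → F}
    (hf : ContDiffOn 𝕜 ∞ f U) (i : ℕ) : ContDiffOn 𝕜 ∞ (pd i f) U :=
  (hf.fderiv_of_isOpen hU (by simp)).clm_apply contDiffOn_const

theorem pd_comm {U : Set (Fin g → 𝕜)} (hU : IsOpen U) {f : (Fin g → 𝕜) → F}
    (hf : ContDiffOn 𝕜 ∞ f U) (i j : ℕ) {t : Fin g → 𝕜} (ht : t ∈ U) :
    pd i (pd j f) t = pd j (pd i f) t := by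
  have hsymm : IsSymmSndFDerivAt 𝕜 f t :=
    (hf.contDiffAt (hU.mem_nhds ht)).isSymmSndFDerivAt (by
      rw [minSmoothness_of_isRCLikeNormedField]
      exact WithTop.coe_le_coe.2 (le_top : (2 : ℕ∞) ≤ ⊤))
  have hd : DifferentiableAt 𝕜 (fderiv 𝕜 f) t :=
    ((hf.fderiv_of_isOpen hU (m := ∞) (by simp)).contDiffAt (hU.mem_nhds ht)).differentiableAt
      (by simp)
  have key : ∀ a b : Fin g → 𝕜,
      fderiv 𝕜 (fun s => fderiv 𝕜 f s a) t b = fderiv 𝕜 (fderiv 𝕜 f) t b a := by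
    intro a b
    rw [fderiv_clm_apply hd (differentiableAt_const a)]
    simp
  exact (key _ _).trans ((hsymm _ _).trans (key _ _).symm)

/-! ### The differential algebra of smooth functions -/

/-- The algebra of smooth functions on `U`. -/
def SmoothFun (F : Type*) [RCLike F] [NormedAlgebra 𝕜 F] (U : Set (Fin g → 𝕜)) :
    Subalgebra F (U → F) where
  carrier := {s | ∃ f : (Fin g → 𝕜) → F, ContDiffOn 𝕜 ∞ f U ∧ ∀ t : U, f t = s t}
  mul_mem' := by
    rintro s r ⟨f, hf, hfs⟩ ⟨h, hh, hhr⟩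
    exact ⟨f * h, hf.mul hh, fun t => by simp [hfs, hhr]⟩
  add_mem' := by
    rintro s r ⟨f, hf, hfs⟩ ⟨h, hh, hhr⟩
    exact ⟨f + h, hf.add hh, fun t => by simp [hfs, hhr]⟩
  algebraMap_mem' c := ⟨fun _ => c, contDiffOn_const, fun _ => rfl⟩

variable {U : Set (Fin g → 𝕜)}

/-- The function `f` restricts to `s` on `U`. -/
def Represents (f : (Fin g → 𝕜) → F) (s : SmoothFun F U) : Prop :=
  ∀ t : U, f t = s.1 t

theorem exists_represents {f : (Fin g → 𝕜) → F} (hf : ContDiffOn 𝕜 ∞ f U) :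
    ∃ s : SmoothFun F U, Represents f s :=
  ⟨⟨fun t => f t, f, hf, fun _ => rfl⟩, fun _ => rfl⟩

/-- Some function on the whole space that restricts to `s`. -/
def extension (s : SmoothFun F U) : (Fin g → 𝕜) → F := s.2.choose

theorem represents_extension (s : SmoothFun F U) : Represents (extension s) s :=
  s.2.choose_spec.2

theorem contDiffOn_extension (s : SmoothFun F U) : ContDiffOn 𝕜 ∞ (extension s) U :=
  s.2.choose_spec.1

namespace Represents

variable {f h : (Fin g → 𝕜) → F} {s r : SmoothFun F U}

theorem eqOn (hf : Represents f s) (hh : Represents h s) : Set.EqOn f h U :=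
  fun t ht => (hf ⟨t, ht⟩).trans (hh ⟨t, ht⟩).symm

theorem eq (hf : Represents f s) (hh : Represents h r) (e : Set.EqOn f h U) : s = r :=
  Subtype.ext (funext fun t => (hf t).symm.trans ((e t.2).trans (hh t)))

theorem contDiffOn (hf : Represents f s) : ContDiffOn 𝕜 ∞ f U :=
  (contDiffOn_extension s).congr fun _ ht => hf.eqOn (represents_extension s) ht

theorem differentiableAt (hU : IsOpen U) (hf : Represents f s) {t : Fin g → 𝕜} (ht : t ∈ U) :
    DifferentiableAt 𝕜 f t :=
  (hf.contDiffOn.contDiffAt (hU.mem_nhds ht)).differentiableAt (by simp)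

theorem add (hf : Represents f s) (hh : Represents h r) : Represents (f + h) (s + r) :=
  fun t => congrArg₂ (· + ·) (hf t) (hh t)

theorem sub (hf : Represents f s) (hh : Represents h r) : Represents (f - h) (s - r) :=
  fun t => congrArg₂ (· - ·) (hf t) (hh t)

theorem mul (hf : Represents f s) (hh : Represents h r) : Represents (f * h) (s * r) :=
  fun t => congrArg₂ (· * ·) (hf t) (hh t)

theorem smul (c : F) (hf : Represents f s) : Represents (c • f) (c • s) :=
  fun t => congrArg (c * ·) (hf t)

theorem sum {ι : Type*} (S : Finset ι) {f : ι → (Fin g → 𝕜) → F} {s : ι → SmoothFun F U}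
    (h : ∀ i ∈ S, Represents (f i) (s i)) : Represents (∑ i ∈ S, f i) (∑ i ∈ S, s i) := by
  intro t
  simp only [Finset.sum_apply, AddSubmonoidClass.coe_finsetSum]
  exact sum_congr rfl fun i hi => h i hi t

end Represents

/-- The partial derivative `∂_i` on smooth functions on `U`. -/
def smoothPd (F : Type*) [RCLike F] [NormedAlgebra 𝕜 F] (hU : IsOpen U) (i : ℕ) :
    Derivation F (SmoothFun F U) (SmoothFun F U) :=
  Derivation.mk'
    { toFun := fun s => ⟨fun t => pd i (extension s) t, pd i (extension s),
        contDiffOn_pd hU (contDiffOn_extension s) i, fun _ => rfl⟩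
      map_add' := fun s r => by
        refine Subtype.ext (funext fun t => ?_)
        have h := pd_congr hU (i := i) ((represents_extension (s + r)).eqOn
          ((represents_extension s).add (represents_extension r))) t.2
        exact h.trans (pd_add ((represents_extension s).differentiableAt hU t.2)
          ((represents_extension r).differentiableAt hU t.2))
      map_smul' := fun c s => by
        refine Subtype.ext (funext fun t => ?_)
        have h := pd_congr hU (i := i) ((represents_extension (c • s)).eqOn
          ((represents_extension s).smul c)) t.2
        exact h.trans (pd_const_smul ((represents_extension s).differentiableAt hU t.2) c) }
    (fun s r => by
      refine Subtype.ext (funext fun t => ?_)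
      have h := pd_congr hU (i := i) ((represents_extension (s * r)).eqOn
        ((represents_extension s).mul (represents_extension r))) t.2
      refine (h.trans (pd_mul ((represents_extension s).differentiableAt hU t.2)
        ((represents_extension r).differentiableAt hU t.2))).trans ?_
      rw [represents_extension s t, represents_extension r t]
      rfl)

/-- On an open set derivatives do not depend on the extension used to define `smoothPd`. -/
theorem Represents.pd (hU : IsOpen U) {f : (Fin g → 𝕜) → F} {s : SmoothFun F U}
    (hf : Represents f s) (i : ℕ) : Represents (pd i f) (smoothPd F hU i s) :=
  fun t => pd_congr hU (hf.eqOn (represents_extension s)) t.2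

theorem Represents.iterate_pd (hU : IsOpen U) {f : (Fin g → 𝕜) → F} {s : SmoothFun F U}
    (hf : Represents f s) (i n : ℕ) :
    Represents ((KdV.pd i)^[n] f) ((smoothPd F hU i)^[n] s) := by
  induction n with
  | zero => exact hf
  | succ n ih =>
    rw [Function.iterate_succ_apply', Function.iterate_succ_apply']
    exact ih.pd hU i

theorem smoothPd_comm (hU : IsOpen U) (i j : ℕ) (s : SmoothFun F U) :
    smoothPd F hU i (smoothPd F hU j s) = smoothPd F hU j (smoothPd F hU i s) := by
  have h := represents_extension s
  exact ((h.pd hU j).pd hU i).eq ((h.pd hU i).pd hU j)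
    fun t ht => pd_comm hU (contDiffOn_extension s) i j ht

theorem smoothPd_eq_zero (hU : IsOpen U) {i : ℕ} (hi : i = 0 ∨ g < i) : smoothPd F hU i = 0 := by
  ext1 s
  refine Subtype.ext (funext fun t => ?_)
  have : (fun j : Fin g => if (j : ℕ) + 1 = i then (1 : 𝕜) else 0) = 0 := by
    funext j
    have := j.2
    exact if_neg (by omega)
  change KdV.pd i (extension s) t = 0
  rw [KdV.pd, this, map_zero]

/-- The coordinate `t_1`, carried from `𝕜` to `F`, is the test function `x` of the commutator
computations. -/
theorem exists_coordinate (hg : 1 ≤ g) (hU : IsOpen U) :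
    ∃ x : SmoothFun F U, smoothPd F hU 1 x = 1 := by
  set L : (Fin g → 𝕜) →L[𝕜] F :=
    (Algebra.linearMap 𝕜 F).toContinuousLinearMap.comp (ContinuousLinearMap.proj ⟨0, hg⟩) with hL
  obtain ⟨x, hx⟩ := exists_represents (U := U) L.contDiff.contDiffOn
  refine ⟨x, Subtype.ext (funext fun t => ?_)⟩
  rw [← hx.pd hU 1 t, KdV.pd, L.fderiv, hL]
  simp

theorem exists_algebraMap_eq (hU : IsOpen U) (hUc : IsConnected U) {s : SmoothFun F U}
    (hs : ∀ i ∈ Icc 1 g, smoothPd F hU i s = 0) : ∃ a : F, algebraMap F (SmoothFun F U) a = s := by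
  have h := represents_extension s
  have hz : Set.EqOn (fderiv 𝕜 (extension s)) 0 U := by
    intro t ht
    refine ContinuousLinearMap.coe_injective (LinearMap.pi_ext' fun j => LinearMap.ext_ring ?_)
    have := congrArg (fun r : SmoothFun F U => r.1 ⟨t, ht⟩)
      (hs (j + 1) (mem_Icc.2 ⟨by omega, by omega⟩))
    rw [← h.pd hU (j + 1) ⟨t, ht⟩, KdV.pd] at this
    have e : (Pi.single j 1 : Fin g → 𝕜) = fun k : Fin g => if (k : ℕ) + 1 = j + 1 then 1 else 0 := by
      funext k
      simp [Pi.single_apply, Fin.ext_iff]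
    simpa [e] using this
  obtain ⟨a, ha⟩ := hU.exists_is_const_of_fderiv_eq_zero hUc.isPreconnected
    (fun t ht => (h.differentiableAt hU ht).differentiableWithinAt) hz
  exact ⟨a, Subtype.ext (funext fun t => ((ha t t.2).symm.trans (h t)))⟩

/-! ### Evaluation of differential polynomials -/

/-- Evaluation of differential polynomials at `u ∈ R`. -/
def evalHom {F R : Type*} [Field F] [CommRing R] [Algebra F R] (δ : Derivation F R R) (u : R) :
    DiffPoly F →ₐ[F] R :=
  MvPolynomial.aeval fun j => δ^[j] u

theorem evalHom_X_zero {F R : Type*} [Field F] [CommRing R] [Algebra F R] (δ : Derivation F R R)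
    (u : R) : evalHom δ u (MvPolynomial.X 0) = u := by
  simp [evalHom]

theorem evalHom_D {F R : Type*} [Field F] [CommRing R] [Algebra F R] (δ : Derivation F R R) (u : R)
    (p : DiffPoly F) : evalHom δ u (D F p) = δ (evalHom δ u p) := by
  induction p using MvPolynomial.induction_on with
  | C a =>
    rw [D_C, map_zero, ← MvPolynomial.algebraMap_eq, AlgHom.commutes, Derivation.map_algebraMap]
  | add p q hp hq => simp only [map_add, hp, hq]
  | mul_X p i hp =>
    have hX : ∀ j, evalHom δ u (MvPolynomial.X j) = δ^[j] u := fun j => by simp [evalHom]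
    rw [D_mul, map_add, map_mul, map_mul, map_mul, hp, Derivation.leibniz, D_X, hX, hX,
      Function.iterate_succ_apply']
    rfl

theorem Represents.evalDiffPoly (hU : IsOpen U) {f : (Fin g → 𝕜) → F} {s : SmoothFun F U}
    (hf : Represents f s) (p : DiffPoly F) :
    Represents (evalDiffPoly f p) (evalHom (smoothPd F hU 1) s p) := by
  intro t
  induction p using MvPolynomial.induction_on with
  | C a =>
    rw [← MvPolynomial.algebraMap_eq, AlgHom.commutes]
    simp [KdV.evalDiffPoly]
  | add p q hp hq =>
    rw [map_add]
    simp only [KdV.evalDiffPoly, map_add] at hp hq ⊢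
    exact congrArg₂ (· + ·) hp hq
  | mul_X p i hp =>
    rw [map_mul]
    simp only [KdV.evalDiffPoly, map_mul, MvPolynomial.eval_X] at hp ⊢
    refine congrArg₂ (· * ·) hp ?_
    rw [hf.iterate_pd hU 1 i t]
    simp [evalHom]

/-! ### Operators -/

theorem Represents.opL (hU : IsOpen U) {u : ℕ → (Fin g → 𝕜) → F} {v : ℕ → SmoothFun F U}
    (h1 : Represents (u 1) (v 1)) {f : (Fin g → 𝕜) → F} {s : SmoothFun F U} (hf : Represents f s) :
    Represents (opL u f) (schrodinger (smoothPd F hU 1) (v 1) s) := by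
  rw [schrodinger_apply]
  exact ((hf.pd hU 1).pd hU 1).sub (h1.mul hf)

theorem Represents.iterate_opL (hU : IsOpen U) {u : ℕ → (Fin g → 𝕜) → F} {v : ℕ → SmoothFun F U}
    (h1 : Represents (u 1) (v 1)) {f : (Fin g → 𝕜) → F} {s : SmoothFun F U} (hf : Represents f s)
    (n : ℕ) :
    Represents ((KdV.opL u)^[n] f) ((schrodinger (smoothPd F hU 1) (v 1) ^ n) s) := by
  induction n with
  | zero => exact hf
  | succ n ih =>
    rw [Function.iterate_succ_apply', pow_succ', Module.End.mul_apply]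
    exact h1.opL hU ih

theorem Represents.opU (hU : IsOpen U) {u : ℕ → (Fin g → 𝕜) → F} {v : ℕ → SmoothFun F U} {k : ℕ}
    (h1 : Represents (u 1) (v 1)) (hk : Represents (u k) (v k)) {f : (Fin g → 𝕜) → F}
    {s : SmoothFun F U} (hf : Represents f s) :
    Represents (opU u k f) (evolutionOp (smoothPd F hU) v k s) := by
  have e : evolutionOp (smoothPd F hU) v k s =
      smoothPd F hU 1 (smoothPd F hU 1 (smoothPd F hU k s))
        - (1 / 2 : F) • (v 1 * smoothPd F hU k s + smoothPd F hU k (v 1 * s))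
        - (1 / 4 : F) • (v k * smoothPd F hU 1 s + smoothPd F hU 1 (v k * s))
        - smoothPd F hU (k + 1) s := by
    simp only [evolutionOp, pow_two, LinearMap.sub_apply, LinearMap.smul_apply, LinearMap.add_apply,
      Module.End.mul_apply, LinearMap.mulLeft_apply, Derivation.coeFn_coe]
  rw [e]
  exact (((((hf.pd hU k).pd hU 1).pd hU 1).sub
    (((h1.mul (hf.pd hU k)).add ((h1.mul hf).pd hU k)).smul _)).sub
    (((hk.mul (hf.pd hU 1)).add ((hk.mul hf).pd hU 1)).smul _)).sub (hf.pd hU (k + 1))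

theorem Represents.opLax (hU : IsOpen U) {w f : (Fin g → 𝕜) → F} {v s : SmoothFun F U}
    (hw : Represents w v) (hf : Represents f s) (k : ℕ) :
    Represents (opLax w k f)
      (realize (smoothPd F hU 1) (evalHom (smoothPd F hU 1) v) (lenardOp F k) s) := by
  rw [KdV.opLax, laxOperator_eq_lenardOp, realize, Finsupp.sum, Finsupp.sum, LinearMap.sum_apply]
  refine Represents.sum _ fun i _ => ?_
  rw [Module.End.mul_apply, LinearMap.mulLeft_apply, Module.End.pow_apply]
  exact (hw.evalDiffPoly hU _).mul (hf.iterate_pd hU 1 i)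

/-- Every element of the algebra is represented by a smooth function, so commutation on functions
becomes commutation of endomorphisms. -/
theorem mul_eq_mul_of_opCommuteOn {P Q : ((Fin g → 𝕜) → F) → ((Fin g → 𝕜) → F)}
    {S T : Module.End F (SmoothFun F U)}
    (hP : ∀ f s, Represents f s → Represents (P f) (S s))
    (hQ : ∀ f s, Represents f s → Represents (Q f) (T s)) (h : OpCommuteOn U P Q) :
    S * T = T * S := by
  refine LinearMap.ext fun s => ?_
  have hs := represents_extension s
  exact (hP _ _ (hQ _ _ hs)).eq (hQ _ _ (hP _ _ hs)) (h _ hs.contDiffOn)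

end SmoothFunctions

end
end KdV

namespace KdV
noncomputable section

open Finset

/-! ### Translation back to functions, and the theorem. -/

section Main

variable {𝕜 F : Type*} [RCLike 𝕜] [RCLike F] [NormedAlgebra 𝕜 F] {g : ℕ} {U : Set (Fin g → 𝕜)}

theorem exists_sequence {u : ℕ → (Fin g → 𝕜) → F}
    (hu : ∀ i ∈ Icc 1 g, ContDiffOn 𝕜 ∞ (u i) U) :
    ∃ v : ℕ → SmoothFun F U, v 0 = -2 ∧ (∀ j, g < j → v j = 0) ∧
      ∀ j ∈ Icc 1 g, Represents (u j) (v j) := by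
  classical
  choose! s hs using fun j (hj : j ∈ Icc 1 g) => exists_represents (hu j hj)
  refine ⟨fun j => if j = 0 then -2 else if g < j then 0 else s j, by simp, fun j hj => ?_,
    fun j hj => ?_⟩
  · simp [hj, show j ≠ 0 by omega]
  · have := mem_Icc.1 hj
    simpa [show j ≠ 0 by omega, show ¬ g < j by omega] using hs j hj

theorem represents_sum_opU (hU : IsOpen U) {u : ℕ → (Fin g → 𝕜) → F} {v : ℕ → SmoothFun F U}
    (hg : 1 ≤ g) (huv : ∀ j ∈ Icc 1 g, Represents (u j) (v j)) {f : (Fin g → 𝕜) → F}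
    {s : SmoothFun F U} (hf : Represents f s) :
    Represents (∑ k ∈ Icc 1 g, opU u k ((opL u)^[g - k] f))
      ((∑ k ∈ Icc 1 g, evolutionOp (smoothPd F hU) v k *
        schrodinger (smoothPd F hU 1) (v 1) ^ (g - k)) s) := by
  have h1 := huv 1 (mem_Icc.2 ⟨le_rfl, hg⟩)
  rw [LinearMap.sum_apply]
  refine Represents.sum _ fun k hk => ?_
  rw [Module.End.mul_apply]
  exact h1.opU hU (huv k hk) (h1.iterate_opL hU hf _)

theorem represents_sum_opLax (hU : IsOpen U) {w f : (Fin g → 𝕜) → F} {v s : SmoothFun F U}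
    (hw : Represents w v) (hf : Represents f s) (a : ℕ → F) :
    Represents (opLax w g f + ∑ i ∈ range (g - 1), a i • opLax w i f)
      ((realize (smoothPd F hU 1) (evalHom (smoothPd F hU 1) v) (lenardOp F g)
        + ∑ i ∈ range (g - 1),
          a i • realize (smoothPd F hU 1) (evalHom (smoothPd F hU 1) v) (lenardOp F i)) s) := by
  rw [LinearMap.add_apply, LinearMap.sum_apply]
  refine (hw.opLax hU hf g).add (Represents.sum _ fun i _ => ?_)
  rw [LinearMap.smul_apply]
  exact (hw.opLax hU hf i).smul _

theorem novikovEq_iff (hU : IsOpen U) {w : (Fin g → 𝕜) → F} {v : SmoothFun F U}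
    (hw : Represents w v) (a : ℕ → F) : NovikovEq U a w ↔
      smoothPd F hU 1 (evalHom (smoothPd F hU 1) v (lenard F (g + 1)))
        + ∑ k ∈ range (g - 1), a k • smoothPd F hU 1
          (evalHom (smoothPd F hU 1) v (lenard F (k + 1))) = 0 := by
  have hk : ∀ k, Represents (evalDiffPoly w (kdvPoly F k))
      (-smoothPd F hU 1 (evalHom (smoothPd F hU 1) v (lenard F (k + 1)))) := fun k => by
    have := hw.evalDiffPoly hU (kdvPoly F k)
    rwa [kdvPoly_eq, map_neg, evalHom_D, ← kdvPoly_eq] at this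
  have hsum := (hk g).add (Represents.sum (range (g - 1)) fun k _ => (hk k).smul (a k))
  simp only [smul_neg, sum_neg_distrib, ← neg_add] at hsum
  have h0 : Represents (U := U) (0 : (Fin g → 𝕜) → F) 0 := fun _ => rfl
  constructor
  · intro h
    rw [← neg_eq_zero]
    refine hsum.eq h0 fun t ht => ?_
    simpa using h t ht
  · intro h t ht
    rw [h, neg_zero] at hsum
    simpa using hsum.eqOn h0 ht

theorem sum_range_eq_gen_sub_two {v : ℕ → SmoothFun F U} {u : ℕ → (Fin g → 𝕜) → F}
    (hv : ∀ j ∈ Icc 1 g, Represents (u j) (v j)) (t : U) (ξ : F) :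
    ∑ i ∈ range (g + 1), (v i).1 t * ξ ^ i = (v 0).1 t + gen u t ξ := by
  rw [sum_range_succ', pow_zero, mul_one, add_comm, gen, ← Finset.Ico_add_one_right_eq_Icc,
    sum_Ico_eq_sum_range, Nat.add_sub_cancel]
  congr 1
  refine sum_congr rfl fun i hi => ?_
  have := Finset.mem_range.1 hi
  rw [add_comm i 1, hv (1 + i) (mem_Icc.2 ⟨by omega, by omega⟩) t]

/-- The curve equation follows from the identity of formal power series. -/
theorem curveEq_of_energy_eq (hU : IsOpen U) (hg : 1 ≤ g) {u : ℕ → (Fin g → 𝕜) → F}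
    {v : ℕ → SmoothFun F U} (hv0 : v 0 = -2) (hvg : ∀ j, g < j → v j = 0)
    (huv : ∀ j ∈ Icc 1 g, Represents (u j) (v j)) {m : PowerSeries F}
    (hm0 : PowerSeries.coeff 0 m = 16) (hm1 : PowerSeries.coeff 1 m = 0)
    (hm : energy (smoothPd F hU 1) (v 1) (PowerSeries.mk v) =
      PowerSeries.map (algebraMap F (SmoothFun F U)) m) :
    CurveEq U u fun i => PowerSeries.coeff (i + 1) m / 4 := by
  intro t ht ξ hξ
  set δ := smoothPd F hU 1 with hδ
  set e : SmoothFun F U →+* F := (Pi.evalRingHom _ ⟨t, ht⟩).comp (SmoothFun F U).val.toRingHom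
    with he
  have he' : ∀ s : SmoothFun F U, e s = s.1 ⟨t, ht⟩ := fun s => rfl
  have hid : (PowerSeries.map e) (PowerSeries.map (algebraMap F (SmoothFun F U)) m) = m := by
    ext n
    simp only [PowerSeries.coeff_map]
    rfl
  have hd : coeffDeriv δ (PowerSeries.mk v) = PowerSeries.mk fun n => δ (v n) := by ext n; simp
  have hdd : coeffDeriv δ (PowerSeries.mk fun n => δ (v n)) =
      PowerSeries.mk fun n => δ (δ (v n)) := by ext n; simp
  have hmap : ∀ a : ℕ → SmoothFun F U,
      PowerSeries.map e (PowerSeries.mk a) = PowerSeries.mk fun n => e (a n) := fun a => by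
    ext n; simp
  have h := congrArg (PowerSeries.map e) hm
  rw [hid] at h
  simp only [energy, hd, hdd, map_add, map_mul, map_sub, map_pow, map_one, PowerSeries.map_X,
    PowerSeries.map_C, hmap] at h
  rw [map_ofNat, map_ofNat] at h
  have hz : ∀ j, g < j → e (v j) = 0 ∧ e (δ (v j)) = 0 ∧ e (δ (δ (v j))) = 0 := fun j hj => by
    simp [hvg j hj]
  have hsum := sum_coeff_energy_eq (fun j hj => (hz j hj).1) (fun j hj => (hz j hj).2.1)
    (fun j hj => (hz j hj).2.2) h ξ
  simp only [he'] at hsum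
  rw [sum_range_eq_gen_sub_two (v := fun i => δ (δ (v i)))
      (fun j hj => ((huv j hj).pd hU 1).pd hU 1) ⟨t, ht⟩,
    sum_range_eq_gen_sub_two (v := fun i => δ (v i)) (fun j hj => (huv j hj).pd hU 1) ⟨t, ht⟩,
    sum_range_eq_gen_sub_two huv ⟨t, ht⟩, derivation_apply_zero (d := fun _ => δ) hv0 0,
    map_zero, hv0, ← huv 1 (mem_Icc.2 ⟨le_rfl, hg⟩) ⟨t, ht⟩] at hsum
  have hneg2 : (-2 : SmoothFun F U).1 ⟨t, ht⟩ = -2 := rfl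
  have hzero : (0 : SmoothFun F U).1 ⟨t, ht⟩ = 0 := rfl
  -- The coefficients `16` and `0` account for the term `4 ξ⁻¹` and the missing constant term of
  -- `μ(ξ)`; what remains is divided by `4 ξ`.
  rw [hneg2, hzero, zero_add, zero_add, sum_range_succ', sum_range_succ', zero_add, hm0, hm1,
    zero_mul, add_zero, pow_zero, mul_one] at hsum
  have hleft : ∑ i ∈ Icc 1 (2 * g), PowerSeries.coeff (i + 1) m / 4 * ξ ^ i =
      (∑ k ∈ range (2 * g), PowerSeries.coeff (k + 1 + 1) m * ξ ^ (k + 1 + 1)) / (4 * ξ) := by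
    rw [← Finset.Ico_add_one_right_eq_Icc, sum_Ico_eq_sum_range, Nat.add_sub_cancel, sum_div]
    refine sum_congr rfl fun i _ => ?_
    rw [add_comm 1 i]
    field_simp
    ring
  rw [hleft, eq_sub_of_add_eq hsum]
  field_simp
  ring

end Main

end
end KdV

theorem mainTheorem4 {𝕜 F : Type*} [RCLike 𝕜] [RCLike F] [NormedAlgebra 𝕜 F]
    (g : ℕ) (hg : 1 ≤ g) (U : Set (Fin g → 𝕜)) (hUo : IsOpen U) (hUc : IsConnected U)
    (u : ℕ → (Fin g → 𝕜) → F) (hu : ∀ i ∈ Finset.Icc 1 g, ContDiffOn 𝕜 ∞ (u i) U)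
    (hcomm : KdV.CommutingFamily U u) :
    ∃ μ : ℕ → F, KdV.CurveEq U u μ ∧
      ∃ a : ℕ → F,
        KdV.OpEqOn U
          (fun f => KdV.opLax (u 1) g f
            + ∑ i ∈ Finset.range (g - 1), a i • KdV.opLax (u 1) i f)
          (fun f => ∑ k ∈ Finset.Icc 1 g, KdV.opU u k ((KdV.opL u)^[g - k] f)) ∧
        KdV.NovikovEq U a (u 1) ∧
        (∀ k ∈ Finset.Icc 1 (g - 1),
          μ k = 8 * a (g - k - 1)
            + 4 * ∑ i ∈ Finset.Icc 1 (k - 2), a (g - i - 1) * a (g - k + i)) ∧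
        (KdV.IndependentDerivatives U (u 1) →
          ∀ b : ℕ → F, KdV.NovikovEq U b (u 1) → ∀ i < g - 1, b i = a i) := by
  open KdV in
  obtain ⟨v, hv0, hvg, huv⟩ := exists_sequence hu
  have h1 := huv 1 (Finset.mem_Icc.2 ⟨le_rfl, hg⟩)
  set d := smoothPd F hUo with hd
  have hd0 : d 0 = 0 := smoothPd_eq_zero hUo (Or.inl rfl)
  have hdg : ∀ i, g < i → d i = 0 := fun i hi => smoothPd_eq_zero hUo (Or.inr hi)
  have hdc : ∀ i j f, d i (d j f) = d j (d i f) := smoothPd_comm hUo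
  obtain ⟨x, hx⟩ := exists_coordinate (F := F) hg hUo
  have hL : ∀ k ∈ Finset.Icc 1 g, schrodinger (d 1) (v 1) * evolutionOp d v k =
      evolutionOp d v k * schrodinger (d 1) (v 1) := fun k hk =>
    mul_eq_mul_of_opCommuteOn (fun _ _ hf => h1.opL hUo hf)
      (fun _ _ hf => h1.opU hUo (huv k hk) hf) (hcomm.1 k hk)
  have hU : ∀ i ∈ Finset.Icc 1 g, ∀ k ∈ Finset.Icc 1 g, evolutionOp d v i * evolutionOp d v k =
      evolutionOp d v k * evolutionOp d v i := fun i hi k hk =>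
    mul_eq_mul_of_opCommuteOn (fun _ _ hf => h1.opU hUo (huv i hi) hf)
      (fun _ _ hf => h1.opU hUo (huv k hk) hf) (hcomm.2 i hi k hk)
  obtain ⟨m, hm⟩ := exists_map_eq_energy hv0 hvg hd0 hdg hdc hx
    (fun _ h => exists_algebraMap_eq hUo hUc h) hL hU
  have hpot := derivation_potential hv0 hvg hd0 hdg hdc hx hL
  -- Makes the function algebra nontrivial, so that constants embed.
  have : Nonempty U := hUc.nonempty.to_subtype
  set φ := evalHom (d 1) (v 1) with hφ
  obtain ⟨c, hc0, hc1, hmc, hvc⟩ := exists_coefficients (φ := φ) (evalHom_D (d 1) (v 1)) hv0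
    (evalHom_X_zero (d 1) (v 1)) hm
  have hm0 : PowerSeries.coeff 0 m = 16 := by
    rw [hmc, PowerSeries.coeff_C_mul, pow_two, PowerSeries.coeff_mul]
    simp [hc0]
  have hm1 : PowerSeries.coeff 1 m = 0 := by
    rw [hmc, PowerSeries.coeff_C_mul, pow_two, PowerSeries.coeff_mul,
      Finset.Nat.sum_antidiagonal_succ]
    simp [hc1]
  -- The constants are `a_k = c_{g-k}`.
  have hnov : NovikovEq U (fun k => c (g - k)) (u 1) := by
    rw [novikovEq_iff hUo h1]
    have := sum_deriv_lenard_eq_zero (δ := d 1) hvc (hvg (g + 1) (Nat.lt_succ_self g))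
    rwa [sum_range_of_normalized hc0 hc1 hg fun k => d 1 (φ (lenard F (k + 1)))] at this
  refine ⟨_, curveEq_of_energy_eq hUo hg hv0 hvg huv hm0 hm1 hm, fun k => c (g - k), ?_, hnov,
    fun k hk => ?_, fun hind b hb i hi => ?_⟩
  · intro f hf
    obtain ⟨s, hs⟩ := exists_represents hf
    have hl := represents_sum_opLax hUo h1 hs fun k => c (g - k)
    have hr := represents_sum_opU hUo hg huv hs
    rw [sum_evolutionOp hv0 (fun i f => hdc i 1 f) hpot (hdg _ (Nat.lt_succ_self g))] at hr
    have hsum := sum_realize_lenardOp (evalHom_D (d 1) (v 1)) hvc g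
    rw [evalHom_X_zero, sum_range_of_normalized hc0 hc1 hg
      fun k => realize (d 1) (evalHom (d 1) (v 1)) (lenardOp F k)] at hsum
    rw [← hsum] at hr
    exact hl.eqOn hr
  · simp only
    rw [hmc, PowerSeries.coeff_C_mul, coeff_succ_sq_of_normalized hc0 hc1 hk]
    ring
  · have hind' : ∀ γ : ℕ → F, ∑ j ∈ Finset.Icc 1 g, γ j • d 1 (v j) = 0 →
        ∀ j ∈ Finset.Icc 1 g, γ j = 0 := by
      intro γ hγ
      refine hind γ fun t ht => ?_
      have hrep : Represents (∑ j ∈ Finset.Icc 1 g, γ j • pd j (u 1))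
          (∑ j ∈ Finset.Icc 1 g, γ j • d 1 (v j)) := Represents.sum _ fun j _ => by
        rw [← hpot]
        exact (h1.pd hUo j).smul _
      rw [hγ] at hrep
      simpa using hrep ⟨t, ht⟩
    have hb' := (novikovEq_iff hUo h1 b).1 hb
    have ha' := (novikovEq_iff hUo h1 _).1 hnov
    refine sub_eq_zero.1 (eq_zero_of_sum_deriv_lenard_eq_zero (β := fun k => b k - c (g - k))
      hc0 hv0 hvc hind' ?_ i hi)
    simp only [sub_smul, Finset.sum_sub_distrib]
    rw [← sub_eq_zero.2 (hb'.trans ha'.symm)]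
    abel
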